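/- A composition is a finite non-empty sequence $\mathbf k=(k_1,\dots,k_r)$ of positive integers, with weight $|\mathbf k|=k_1+\cdots+k_r$ and depth $\operatorname{dep}(\mathbf k)=r$; put $\overleftarrow{\mathbf k}=(k_r,\dots,k_1)$ and $\mathbf k_+=(k_1+1,k_2,\dots,k_r)$. The Hoffman dual $\mathbf k^\vee=(k_1',\dots,k_{r'}')$ is the unique composition of weight $|\mathbf k|$ such that $\{1,\dots,|\mathbf k|-1\}$ is the disjoint union of $\{\sum_{i\le j}k_i : 1\le j\le r-1\}$ and $\{\sum_{i\le j}k'_i : 1\le j\le r'-1\}$. For a composition $\mathbf k$ with $k_1\ge 2$ let $$\zeta^\star(\mathbf k)=\sum_{n_1\ge\cdots\ge n_r>0}\frac1{n_1^{k_1}\cdots n_r^{k_r}},$$ and for $\mathbf j=(j_1,\dots,j_r)\in\mathbb N_0^r$ let $|\mathbf j|=j_1+\cdots+j_r$, $\operatorname{dep}(\mathbf j)=r$ and $B(\mathbf k;\mathbf j)=\prod_{i=1}^r\binom{k_i+j_i-1}{j_i}$. Let $\mathrm{Li}_{\mathbf k}$ be the multiple polylogarithm on $(-\infty,1)$, i.e.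 the real-analytic continuation (given by iterated integrals) of the series $\sum_{n_1>\cdots>n_r>0}x^{n_1}/(n_1^{k_1}\cdots n_r^{k_r})$, $|x|<1$. For $\operatorname{Re}(s)>0$ the Kaneko–Tsumura $\eta$-function is $$\eta(s;\mathbf k)=\frac1{\Gamma(s)}\int_0^\infty\frac{t^{s-1}}{1-e^t}\,\mathrm{Li}_{\mathbf k}(1-e^t)\,dt .$$ **Theorem.** For every composition $\mathbf k=(k_1,\dots,k_r)$ and every integer $k\ge 0$, $$\eta(k+1;\mathbf k)=(-1)^{r-1}\sum_{\substack{\mathbf j\in\mathbb N_0^n\\ |\mathbf j|=k}}B\big((\overleftarrow{\mathbf k}^\vee)_+;\mathbf j\big)\,\zeta^\star\big((\overleftarrow{\mathbf k}^\vee)_++\mathbf j\big),$$ where $n=|\mathbf k|+1-r$ is the depth of $\overleftarrow{\mathbf k}^\vee$ and the sum of two sequences of the same length is taken componentwise; here the integral defining $\eta(k+1;\mathbf k)$ and all the series $\zeta^\star$ converge absolutely. -/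

import Mathlib

namespace KanekoTsumura

open MeasureTheory Set

/-! ### Compositions -/

/-- The Hoffman dual of a composition `c` of the integer `N`: the composition of `N` whose inner
partial sums are exactly the elements of `{1, …, N - 1}` that are not partial sums of `c`.
(In `Composition.boundaries` the partial sums `0` and `N` are always included.) -/
def hoffmanDual {N : ℕ} (c : Composition N) : Composition N :=
  CompositionAsSet.toComposition
    { boundaries := c.boundariesᶜ ∪ {0, Fin.last N}
      zero_mem := by simp
      getLast_mem := by simp }

/-- `k₊ = (k₁ + 1, k₂, …, kₙ)`. -/
def addOneFirst {n : ℕ} (k : Fin n → ℕ) : Fin n → ℕ :=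
  fun i => if (i : ℕ) = 0 then k i + 1 else k i

/-- `B(k; j) = ∏ᵢ binom(kᵢ + jᵢ - 1, jᵢ)`, for positive integers `kᵢ`. -/
def binomProd {n : ℕ} (k j : Fin n → ℕ) : ℕ :=
  ∏ i, (k i + j i - 1).choose (j i)

/-- The Hoffman dual is characterised by its partial sums. -/
theorem mem_boundaries_hoffmanDual {N : ℕ} (c : Composition N) (i : Fin (N + 1))
    (h0 : i ≠ 0) (hN : i ≠ Fin.last N) :
    i ∈ (hoffmanDual c).boundaries ↔ i ∉ c.boundaries := by
  simp [hoffmanDual, h0, hN]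

/-- The depth of the Hoffman dual is `n = |k| + 1 - dep(k)`. -/
theorem length_hoffmanDual {N : ℕ} (hN : 0 < N) (c : Composition N) :
    (hoffmanDual c).length = N + 1 - c.length := by
  have h := (hoffmanDual c).card_boundaries_eq_succ_length
  have hc := c.card_boundaries_eq_succ_length
  have hne : (0 : Fin (N + 1)) ≠ Fin.last N := by
    intro h; have := congrArg Fin.val h; simp at this; omega
  have h0 : (0 : Fin (N + 1)) ∈ c.boundaries := c.toCompositionAsSet.zero_mem
  have hl : Fin.last N ∈ c.boundaries := c.toCompositionAsSet.getLast_mem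
  have hle := c.length_le
  have hd : Disjoint c.boundariesᶜ ({0, Fin.last N} : Finset (Fin (N + 1))) := by
    rw [Finset.disjoint_left]
    intro a ha hb
    simp only [Finset.mem_compl, Finset.mem_insert, Finset.mem_singleton] at ha hb
    rcases hb with rfl | rfl
    · exact ha h0
    · exact ha hl
  simp only [hoffmanDual, CompositionAsSet.toComposition_boundaries] at h
  rw [Finset.card_union_of_disjoint hd, Finset.card_compl, Finset.card_pair hne, hc,
    Fintype.card_fin] at h
  simp only [hoffmanDual]
  omega

/-! ### Multiple zeta star values -/

/-- The term `1 / (m₁^k₁ ⋯ mₙ^kₙ)`. -/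
noncomputable def zetaTerm {n : ℕ} (k m : Fin n → ℕ) : ℝ :=
  ∏ i, 1 / (m i : ℝ) ^ k i

/-- The index set `m₁ ≥ ⋯ ≥ mₙ > 0` of the multiple zeta star series. -/
abbrev StarIndex (n : ℕ) : Type :=
  {m : Fin n → ℕ // Antitone m ∧ ∀ i, 0 < m i}

/-- `ζ⋆(k) = ∑_{m₁ ≥ ⋯ ≥ mₙ > 0} 1 / (m₁^k₁ ⋯ mₙ^kₙ)`. -/
noncomputable def zetaStar {n : ℕ} (k : Fin n → ℕ) : ℝ :=
  ∑' m : StarIndex n, zetaTerm k m.1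

/-! ### The multiple polylogarithm on `(-∞, 1)` -/

/-- `f ↦ ∫₀ˣ f(t) dt / t`. -/
noncomputable def intDivT (f : ℝ → ℝ) : ℝ → ℝ := fun x => ∫ t in (0 : ℝ)..x, f t / t

/-- `f ↦ ∫₀ˣ f(t) dt / (1 - t)`. -/
noncomputable def intDivOneSub (f : ℝ → ℝ) : ℝ → ℝ := fun x => ∫ t in (0 : ℝ)..x, f t / (1 - t)

/-- The multiple polylogarithm `Li_k(x)` for real `x < 1`, as the iterated integral
`∫₀ˣ (dt/(1-t)) (dt/t)^(k_r - 1) ⋯ (dt/(1-t)) (dt/t)^(k₁ - 1)`. By `hasSum_multiplePolylog` and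
`analyticOnNhd_multiplePolylog` below, it is the (unique) analytic continuation to `(-∞, 1)` of
the series `∑_{n₁ > ⋯ > n_r > 0} x^n₁ / (n₁^k₁ ⋯ n_r^k_r)`, `|x| < 1`. -/
noncomputable def multiplePolylog : List ℕ → ℝ → ℝ
  | [] => fun _ => 1
  | k :: ks => intDivT^[k - 1] (intDivOneSub (multiplePolylog ks))

/-- Termwise integration of a power series. -/
theorem hasSum_integral_powerSeries {a : ℕ → ℝ} {f : ℝ → ℝ} {r : ℝ}
    (h : ∀ x, |x| < r → HasSum (fun n => a n * x ^ n) (f x)) {x : ℝ} (hx : |x| < r) :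
    HasSum (fun n => a n / (n + 1) * x ^ (n + 1)) (∫ t in (0 : ℝ)..x, f t) := by
  have hs : Summable fun n => |a n| * |x| ^ n := by
    obtain ⟨y, hy1, hy2⟩ := exists_between hx
    have hy0 : 0 < y := (abs_nonneg x).trans_lt hy1
    have := (h |x| (by simpa using hx)).summable.norm
    simpa [abs_mul] using this
  have := intervalIntegral.hasSum_integral_of_dominated_convergence (μ := volume) (a := 0) (b := x)
    (F := fun n t => a n * t ^ n) (f := f) (fun n _ => |a n| * |x| ^ n)
    (fun n => by fun_prop)
    (fun n => Filter.Eventually.of_forall fun t ht => by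
      have ht' : |t| ≤ |x| := by
        rcases le_total 0 x with h0 | h0
        · rw [uIoc_of_le h0] at ht
          rw [abs_of_nonneg h0, abs_of_pos ht.1]; exact ht.2
        · rw [uIoc_of_ge h0] at ht
          rw [abs_of_nonpos h0, abs_of_nonpos ht.2]; linarith [ht.1]
      rw [norm_mul, norm_pow, Real.norm_eq_abs, Real.norm_eq_abs]
      gcongr)
    (Filter.Eventually.of_forall fun t _ => hs)
    (by simp)
    (Filter.Eventually.of_forall fun t ht => h t (by
      have ht' : |t| ≤ |x| := by
        rcases le_total 0 x with h0 | h0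
        · rw [uIoc_of_le h0] at ht
          rw [abs_of_nonneg h0, abs_of_pos ht.1]; exact ht.2
        · rw [uIoc_of_ge h0] at ht
          rw [abs_of_nonpos h0, abs_of_nonpos ht.2]; linarith [ht.1]
      linarith))
  have hfun : (fun n : ℕ => a n / (n + 1) * x ^ (n + 1))
      = fun n => ∫ t in (0 : ℝ)..x, a n * t ^ n := by
    funext n
    rw [intervalIntegral.integral_const_mul, integral_pow]
    simp only [ne_eq, Nat.add_eq_zero_iff, one_ne_zero, and_false, not_false_eq_true, zero_pow,
      sub_zero]
    ring
  rw [hfun]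
  exact this

theorem analyticOnNhd_primitive {f : ℝ → ℝ} (hf : AnalyticOnNhd ℝ f (Iio 1)) :
    AnalyticOnNhd ℝ (fun x => ∫ t in (0 : ℝ)..x, f t) (Iio 1) := by
  intro x₀ hx₀
  obtain ⟨p, hp⟩ := hf x₀ hx₀
  rw [hasFPowerSeriesAt_iff] at hp
  obtain ⟨r, hr, hp⟩ := Metric.eventually_nhds_iff.1 hp
  have hx1 : 0 < 1 - x₀ := by simpa using hx₀
  have key := fun (z : ℝ) (hz : |z| < r) =>
    hasSum_integral_powerSeries (a := p.coeff) (f := fun z => f (x₀ + z)) (r := r)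
      (fun x hx => by simpa [mul_comm] using hp (y := x) (by simpa using hx)) hz
  let b : ℕ → ℝ := fun n => match n with
    | 0 => ∫ t in (0 : ℝ)..x₀, f t
    | n + 1 => p.coeff n / (n + 1)
  refine ⟨FormalMultilinearSeries.ofScalars ℝ b, ?_⟩
  rw [hasFPowerSeriesAt_iff]
  refine Metric.eventually_nhds_iff.2 ⟨min r (1 - x₀), by positivity, fun z hz => ?_⟩
  have hz' : |z| < min r (1 - x₀) := by simpa using hz
  have hz1 := hz'.trans_le (min_le_left _ _)
  have hz2 := hz'.trans_le (min_le_right _ _)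
  have hint : ∀ u v : ℝ, u < 1 → v < 1 → IntervalIntegrable f volume u v := fun u v hu hv =>
    (hf.continuousOn.mono (by
      intro t ht
      exact ht.2.trans_lt (max_lt hu hv))).intervalIntegrable
  have hsplit : ∫ t in (0 : ℝ)..(x₀ + z), f t
      = b 0 + ∫ t in (0 : ℝ)..z, f (x₀ + t) := by
    rw [intervalIntegral.integral_comp_add_left, add_zero]
    exact (intervalIntegral.integral_add_adjacent_intervals (hint 0 x₀ one_pos hx₀)
      (hint _ _ hx₀ (by linarith [le_abs_self z]))).symm
  rw [hsplit]
  have h1 : HasSum (fun n => z ^ (n + 1) • b (n + 1)) (∫ t in (0 : ℝ)..z, f (x₀ + t)) := by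
    simpa [b, mul_comm] using key z hz1
  have h2 : HasSum (fun n => z ^ n • b n) (b 0 + ∫ t in (0 : ℝ)..z, f (x₀ + t)) := by
    refine (hasSum_nat_add_iff' 1).1 ?_
    simpa using h1
  simpa [FormalMultilinearSeries.coeff_ofScalars] using h2

theorem integral_congr_off_zero {f g : ℝ → ℝ} (h : ∀ t, t ≠ 0 → f t = g t) (x : ℝ) :
    ∫ t in (0 : ℝ)..x, f t = ∫ t in (0 : ℝ)..x, g t := by
  refine intervalIntegral.integral_congr_ae ?_
  have : ∀ᵐ t : ℝ, t ≠ 0 := by simp [ae_iff]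
  filter_upwards [this] with t ht _ using h t ht

theorem analyticOnNhd_intDivT {f : ℝ → ℝ} (hf : AnalyticOnNhd ℝ f (Iio 1)) (h0 : f 0 = 0) :
    AnalyticOnNhd ℝ (intDivT f) (Iio 1) := by
  have hd : AnalyticOnNhd ℝ (dslope f 0) (Iio 1) := by
    intro x hx
    rcases eq_or_ne x 0 with rfl | hne
    · obtain ⟨p, hp⟩ := hf 0 hx
      exact ⟨_, hp.has_fpower_series_dslope_fslope⟩
    · have h1 : AnalyticAt ℝ (fun t => f t / t) x := (hf x hx).div analyticAt_id hne
      refine h1.congr ?_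
      filter_upwards [isOpen_ne.mem_nhds hne] with t ht
      rw [dslope_of_ne f ht, slope_def_field, h0, sub_zero, sub_zero]
  have : intDivT f = fun x => ∫ t in (0 : ℝ)..x, dslope f 0 t := by
    funext x
    refine integral_congr_off_zero (fun t ht => ?_) x
    rw [dslope_of_ne f ht, slope_def_field, h0, sub_zero, sub_zero]
  rw [this]
  exact analyticOnNhd_primitive hd

theorem analyticOnNhd_intDivOneSub {f : ℝ → ℝ} (hf : AnalyticOnNhd ℝ f (Iio 1)) :
    AnalyticOnNhd ℝ (intDivOneSub f) (Iio 1) :=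
  analyticOnNhd_primitive (f := fun t => f t / (1 - t)) fun x hx =>
    (hf x hx).div (analyticAt_const.sub analyticAt_id) (by
      have : x < 1 := hx
      simpa [sub_eq_zero] using this.ne')

theorem analyticOnNhd_multiplePolylog (ks : List ℕ) :
    AnalyticOnNhd ℝ (multiplePolylog ks) (Iio 1) := by
  induction ks with
  | nil => exact fun x _ => analyticAt_const
  | cons k ks ih =>
    have : ∀ j : ℕ, AnalyticOnNhd ℝ (intDivT^[j] (intDivOneSub (multiplePolylog ks))) (Iio 1) ∧
        intDivT^[j] (intDivOneSub (multiplePolylog ks)) 0 = 0 := by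
      intro j
      induction j with
      | zero => exact ⟨analyticOnNhd_intDivOneSub ih, by simp [intDivOneSub]⟩
      | succ j hj =>
        rw [Function.iterate_succ_apply']
        exact ⟨analyticOnNhd_intDivT hj.1 hj.2, by simp [intDivT]⟩
    exact (this (k - 1)).1

/-- `∑_{n > n₁ > ⋯ > n_r > 0} 1 / (n₁^k₁ ⋯ n_r^k_r)` for positive `kᵢ`, as a nested sum. -/
noncomputable def truncSum : List ℕ → ℕ → ℝ
  | [], _ => 1
  | k :: ks, n => ∑ m ∈ Finset.range n, truncSum ks m / (m : ℝ) ^ k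

theorem hasSum_intDivT {b : ℕ → ℝ} {f : ℝ → ℝ} (hb : b 0 = 0)
    (h : ∀ x, |x| < 1 → HasSum (fun n => b n * x ^ n) (f x)) {x : ℝ} (hx : |x| < 1) :
    HasSum (fun n => b n / n * x ^ n) (intDivT f x) := by
  have h0 : ∀ t, t ≠ 0 → |t| < 1 → HasSum (fun n => b (n + 1) * t ^ n) (f t / t) := by
    intro t ht ht1
    have h1 := (hasSum_nat_add_iff' (f := fun n => b n * t ^ n) 1).2 (h t ht1)
    have h2 := h1.div_const t
    simp only [Finset.range_one, Finset.sum_singleton, hb, zero_mul, sub_zero] at h2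
    have hfun : (fun n => b (n + 1) * t ^ n) = fun n => b (n + 1) * t ^ (n + 1) / t := by
      funext n
      rw [pow_succ]
      field_simp
    rw [hfun]
    exact h2
  let g : ℝ → ℝ := fun t => if t = 0 then b 1 else f t / t
  have hg : ∀ t, |t| < 1 → HasSum (fun n => b (n + 1) * t ^ n) (g t) := by
    intro t ht
    rcases eq_or_ne t 0 with rfl | hne
    · have := hasSum_single (f := fun n => b (n + 1) * (0 : ℝ) ^ n) 0 (by
        intro n hn; simp [hn])
      simpa [g] using this
    · simpa [g, hne] using h0 t hne ht
  have h3 := hasSum_integral_powerSeries hg hx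
  have h4 : intDivT f x = ∫ t in (0 : ℝ)..x, g t :=
    integral_congr_off_zero (fun t ht => by simp [g, ht]) x
  rw [h4]
  refine (hasSum_nat_add_iff' 1).1 ?_
  simpa [hb] using h3

theorem hasSum_intDivOneSub {a S : ℕ → ℝ} {f : ℝ → ℝ}
    (hS : ∀ n, ∑ m ∈ Finset.range (n + 1), a m = S (n + 1))
    (h : ∀ x, |x| < 1 → HasSum (fun n => a n * x ^ n) (f x)) {x : ℝ} (hx : |x| < 1) :
    HasSum (fun n : ℕ => S n / n * x ^ n) (intDivOneSub f x) := by
  have hg : ∀ t, |t| < 1 → HasSum (fun n => S (n + 1) * t ^ n) (f t / (1 - t)) := by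
    intro t ht
    have h1 := h t ht
    have h2 := hasSum_geometric_of_abs_lt_one ht
    have h3 := hasSum_sum_range_mul_of_summable_norm h1.summable.norm h2.summable.norm
    rw [h1.tsum_eq, h2.tsum_eq, ← div_eq_mul_inv] at h3
    suffices hfun : (fun n => S (n + 1) * t ^ n)
        = fun n => ∑ k ∈ Finset.range (n + 1), a k * t ^ k * t ^ (n - k) by
      rw [hfun]
      exact h3
    funext n
    rw [← hS, Finset.sum_mul]
    refine Finset.sum_congr rfl fun m hm => ?_
    have : m ≤ n := by simpa [Nat.lt_succ_iff] using hm
    rw [mul_assoc, ← pow_add, Nat.add_sub_cancel' this]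
  have h3 := hasSum_integral_powerSeries hg hx
  refine (hasSum_nat_add_iff' 1).1 ?_
  simpa [intDivOneSub] using h3

theorem hasSum_nested (k : ℕ) (ks : List ℕ) (hk : 0 < k) (hks : ∀ j ∈ ks, 0 < j) {x : ℝ}
    (hx : |x| < 1) :
    HasSum (fun n : ℕ => truncSum ks n / (n : ℝ) ^ k * x ^ n) (multiplePolylog (k :: ks) x) := by
  have step : ∀ (ks : List ℕ), (∀ x : ℝ, |x| < 1 →
      HasSum (fun n : ℕ => truncSum ks n / n * x ^ n) (intDivOneSub (multiplePolylog ks) x)) →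
      ∀ j : ℕ, ∀ x : ℝ, |x| < 1 → HasSum (fun n : ℕ => truncSum ks n / (n : ℝ) ^ (j + 1) * x ^ n)
        (intDivT^[j] (intDivOneSub (multiplePolylog ks)) x) := by
    intro ks h j
    induction j with
    | zero => simpa using h
    | succ j ih =>
      intro x hx
      rw [Function.iterate_succ_apply']
      have := hasSum_intDivT (by simp) ih hx
      simpa [div_div, ← pow_succ] using this
  have base : ∀ (ks : List ℕ), (∀ j ∈ ks, 0 < j) → ∀ x : ℝ, |x| < 1 →
      HasSum (fun n : ℕ => truncSum ks n / n * x ^ n)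
        (intDivOneSub (multiplePolylog ks) x) := by
    intro ks
    induction ks with
    | nil =>
      intro _ x hx
      refine hasSum_intDivOneSub (a := fun n => if n = 0 then 1 else 0) (S := truncSum [])
        (fun n => by simp [truncSum]) (fun x _ => ?_) hx
      have := hasSum_ite_eq (0 : ℕ) (1 : ℝ)
      have hfun : (fun n : ℕ => (if n = 0 then (1 : ℝ) else 0) * x ^ n)
          = fun n => if n = 0 then 1 else 0 := by
        funext n
        by_cases hn : n = 0 <;> simp [hn]
      rw [hfun]
      exact this
    | cons k ks ih =>
      intro hpos x hx
      have hk : 0 < k := hpos k (by simp)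
      refine hasSum_intDivOneSub (a := fun n : ℕ => truncSum ks n / (n : ℝ) ^ k)
        (fun n => rfl) (fun x hx => ?_) hx
      have := step ks (ih fun j hj => hpos j (by simp [hj])) (k - 1) x hx
      rwa [Nat.sub_add_cancel hk] at this
  have := step ks (base ks hks) (k - 1) x hx
  rwa [Nat.sub_add_cancel hk] at this

theorem strictAnti_cons {r a : ℕ} {m : Fin r → ℕ} :
    StrictAnti (Fin.cons a m : Fin (r + 1) → ℕ) ↔ StrictAnti m ∧ ∀ i, m i < a := by
  constructor
  · intro h
    exact ⟨fun i j hij => by simpa using h (Fin.succ_lt_succ_iff.2 hij),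
      fun i => by simpa using h (Fin.succ_pos i)⟩
  · rintro ⟨h1, h2⟩ i j hij
    induction j using Fin.cases with
    | zero => simp at hij
    | succ j =>
      induction i using Fin.cases with
      | zero => simpa using h2 j
      | succ i => simpa using h1 (Fin.succ_lt_succ_iff.1 hij)

open Classical in
/-- The term of the tuple `m` in `truncSum ks n`. -/
noncomputable def truncTerm (ks : List ℕ) (n : ℕ) (m : Fin ks.length → ℕ) : ℝ :=
  if StrictAnti m ∧ ∀ i, m i < n then zetaTerm ks.get m else 0

theorem zetaTerm_nonneg {n : ℕ} (k m : Fin n → ℕ) : 0 ≤ zetaTerm k m :=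
  Finset.prod_nonneg fun _ _ => by positivity

theorem truncTerm_nonneg (ks : List ℕ) (n : ℕ) (m : Fin ks.length → ℕ) : 0 ≤ truncTerm ks n m := by
  unfold truncTerm
  split_ifs
  · exact zetaTerm_nonneg _ _
  · exact le_rfl

theorem zetaTerm_cons (k : ℕ) (ks : List ℕ) (a : ℕ) (m : Fin ks.length → ℕ) :
    zetaTerm (k :: ks).get (Fin.cons a m : Fin (ks.length + 1) → ℕ)
      = 1 / (a : ℝ) ^ k * zetaTerm ks.get m := by
  simp only [zetaTerm, List.length_cons]
  rw [Fin.prod_univ_succ]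
  rfl

theorem hasSum_cons {r : ℕ} {F : (Fin (r + 1) → ℕ) → ℝ} {c S : ℕ → ℝ}
    {g : ℕ → (Fin r → ℕ) → ℝ} {L : ℝ} (hF : ∀ a m, F (Fin.cons a m) = c a * g a m)
    (hg : ∀ a m, 0 ≤ g a m) (hgS : ∀ a, HasSum (g a) (S a))
    (hs : Summable fun a => |c a| * S a) (hL : HasSum (fun a => c a * S a) L) : HasSum F L := by
  rw [← (Fin.consEquiv (fun _ : Fin (r + 1) => ℕ)).hasSum_iff]
  have hfun : (F ∘ (Fin.consEquiv (fun _ : Fin (r + 1) => ℕ)))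
      = fun p : ℕ × (Fin r → ℕ) => c p.1 * g p.1 p.2 := by
    funext p
    exact hF p.1 p.2
  rw [hfun]
  have hsum : Summable fun p : ℕ × (Fin r → ℕ) => c p.1 * g p.1 p.2 := by
    refine Summable.of_norm ?_
    rw [summable_prod_of_nonneg (fun _ => norm_nonneg _)]
    have h1 : ∀ a, HasSum (fun m => ‖c a * g a m‖) (|c a| * S a) := by
      intro a
      have := (hgS a).mul_left |c a|
      simpa [abs_mul, abs_of_nonneg (hg a _)] using this
    refine ⟨fun a => (h1 a).summable, ?_⟩
    have h3 : (fun a => ∑' m, ‖c a * g a m‖) = fun a => |c a| * S a :=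
      funext fun a => (h1 a).tsum_eq
    change Summable fun a => ∑' m, ‖c a * g a m‖
    rw [h3]
    exact hs
  have h2 := hsum.hasSum.prod_fiberwise fun a => (hgS a).mul_left (c a)
  rw [hL.unique h2]
  exact hsum.hasSum

theorem hasSum_truncTerm (ks : List ℕ) (n : ℕ) : HasSum (truncTerm ks n) (truncSum ks n) := by
  induction ks generalizing n with
  | nil =>
    have h1 : ∀ m, truncTerm [] n m = 1 := by
      intro m
      have h : StrictAnti m := fun i => i.elim0
      have h' : ∀ i, m i < n := fun i => i.elim0
      simp [truncTerm, zetaTerm, h]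
    have := hasSum_single (f := truncTerm [] n) (fun i => i.elim0) (fun m hm =>
      absurd (funext fun i => i.elim0) hm)
    rwa [h1] at this
  | cons k ks ih =>
    have hterm : ∀ (a : ℕ) (m : Fin ks.length → ℕ),
        truncTerm (k :: ks) n (Fin.cons a m : Fin (ks.length + 1) → ℕ)
          = (if a < n then 1 / (a : ℝ) ^ k else 0) * truncTerm ks a m := by
      intro a m
      have hP : (StrictAnti (Fin.cons a m : Fin (ks.length + 1) → ℕ) ∧
          ∀ i, (Fin.cons a m : Fin (ks.length + 1) → ℕ) i < n) ↔
          a < n ∧ StrictAnti m ∧ ∀ i, m i < a := by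
        rw [strictAnti_cons, Fin.forall_fin_succ]
        simp only [Fin.cons_zero, Fin.cons_succ]
        exact ⟨fun h => ⟨h.2.1, h.1⟩, fun h => ⟨h.2, h.1, fun i => (h.2.2 i).trans h.1⟩⟩
      have := zetaTerm_cons k ks a m
      unfold truncTerm
      rw [this]
      simp only [List.length_cons, hP]
      by_cases h1 : a < n <;> by_cases h2 : StrictAnti m ∧ ∀ i, m i < a <;> simp [h1, h2]
    have hout : HasSum (fun a : ℕ => (if a < n then 1 / (a : ℝ) ^ k else 0) * truncSum ks a)
        (truncSum (k :: ks) n) := by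
      have : HasSum (fun a : ℕ => (if a < n then 1 / (a : ℝ) ^ k else 0) * truncSum ks a)
          (∑ a ∈ Finset.range n, (if a < n then 1 / (a : ℝ) ^ k else 0) * truncSum ks a) :=
        hasSum_sum_of_ne_finset_zero (fun a ha => by
          have : ¬ a < n := by simpa using ha
          simp [this])
      convert this using 1
      refine Finset.sum_congr rfl fun a ha => ?_
      rw [if_pos (by simpa using ha)]
      ring
    refine hasSum_cons hterm (fun a m => truncTerm_nonneg ks a m) ih ?_ hout
    have habs : ∀ a : ℕ, |if a < n then 1 / (a : ℝ) ^ k else 0|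
        = if a < n then 1 / (a : ℝ) ^ k else 0 := by
      intro a
      split_ifs
      · exact abs_of_nonneg (by positivity)
      · exact abs_zero
    simp only [habs]
    exact hout.summable

/-- For `|x| < 1` the multiple polylogarithm is the absolutely convergent series
`∑_{n₁ > ⋯ > n_r > 0} x^n₁ / (n₁^k₁ ⋯ n_r^k_r)`. -/
theorem hasSum_multiplePolylog (k : ℕ) (ks : List ℕ) (hk : 0 < k) (hks : ∀ j ∈ ks, 0 < j) {x : ℝ}
    (hx : |x| < 1) :
    HasSum (fun m : {m : Fin (ks.length + 1) → ℕ // StrictAnti m ∧ ∀ i, 0 < m i} =>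
      x ^ m.1 0 * zetaTerm (k :: ks).get m.1) (multiplePolylog (k :: ks) x) := by
  classical
  have hind : ∀ (a : ℕ) (m : Fin ks.length → ℕ),
      Set.indicator {m : Fin (ks.length + 1) → ℕ | StrictAnti m ∧ ∀ i, 0 < m i}
        (fun m => x ^ m 0 * zetaTerm (k :: ks).get m) (Fin.cons a m : Fin (ks.length + 1) → ℕ)
        = x ^ a / (a : ℝ) ^ k * truncTerm ks a m := by
    intro a m
    have hz := zetaTerm_cons k ks a m
    by_cases h1 : StrictAnti m ∧ ∀ i, m i < a
    · have h1' : StrictAnti (Fin.cons a m : Fin (ks.length + 1) → ℕ) := strictAnti_cons.2 h1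
      by_cases h2 : ∀ i, 0 < (Fin.cons a m : Fin (ks.length + 1) → ℕ) i
      · rw [Set.indicator_of_mem (show _ ∈ {m : Fin (ks.length + 1) → ℕ |
          StrictAnti m ∧ ∀ i, 0 < m i} from ⟨h1', h2⟩), hz, truncTerm, if_pos h1, Fin.cons_zero]
        ring
      · rw [Set.indicator_of_notMem (fun h => h2 h.2)]
        push Not at h2
        obtain ⟨i, hi⟩ := h2
        have hi0 : (Fin.cons a m : Fin (ks.length + 1) → ℕ) i = 0 := by omega
        have hzero : zetaTerm (k :: ks).get (Fin.cons a m : Fin (ks.length + 1) → ℕ) = 0 := by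
          refine Finset.prod_eq_zero (Finset.mem_univ i) ?_
          have hpos : 0 < (k :: ks).get i := by
            have := List.get_mem (k :: ks) i
            rcases List.mem_cons.1 this with h | h
            · rw [h]; exact hk
            · exact hks _ h
          rw [hi0, Nat.cast_zero, zero_pow hpos.ne', div_zero]
        rw [hz] at hzero
        rw [truncTerm, if_pos h1, div_eq_mul_one_div, mul_assoc, hzero, mul_zero]
    · rw [Set.indicator_of_notMem (fun h => h1 (strictAnti_cons.1 h.1)), truncTerm, if_neg h1,
        mul_zero]
  have h1 := hasSum_nested k ks hk hks hx
  have h2 := (hasSum_nested k ks hk hks (x := |x|) (by simpa using hx)).summable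
  refine (hasSum_subtype_iff_indicator
    (f := fun m : Fin (ks.length + 1) → ℕ => x ^ m 0 * zetaTerm (k :: ks).get m)
    (s := {m | StrictAnti m ∧ ∀ i, 0 < m i})).2 ?_
  refine hasSum_cons hind (fun a m => truncTerm_nonneg ks a m) (hasSum_truncTerm ks) ?_ ?_
  · convert h2 using 2 with a
    rw [abs_div, abs_pow, abs_of_nonneg (by positivity : (0 : ℝ) ≤ (a : ℝ) ^ k)]
    ring
  · convert h1 using 2 with a
    ring

/-! ### The Kaneko–Tsumura η-function -/

/-- The integrand `t^(s-1) Li_k(1 - e^t) / (1 - e^t)` of the η-function. -/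
noncomputable def etaIntegrand {N : ℕ} (s : ℂ) (c : Composition N) (t : ℝ) : ℂ :=
  (t : ℂ) ^ (s - 1) / (1 - Real.exp t : ℝ) * (multiplePolylog c.blocks (1 - Real.exp t) : ℝ)

/-- `η(s; k) = (1 / Γ(s)) ∫₀^∞ t^(s-1) Li_k(1 - e^t) / (1 - e^t) dt`, for `Re s > 0`. -/
noncomputable def eta {N : ℕ} (s : ℂ) (c : Composition N) : ℂ :=
  1 / Complex.Gamma s * ∫ t in Ioi (0 : ℝ), etaIntegrand s c t

/-- The composition `(k̄^∨)₊`: Hoffman dual of the reversal, with `1` added to its first part. -/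
def dualPlus {N : ℕ} (c : Composition N) : Fin (hoffmanDual c.reverse).length → ℕ :=
  addOneFirst (hoffmanDual c.reverse).blocksFun

end KanekoTsumura

/-! Substitute `x = 1 - e^t` in the iterated integral for `Li`. The form `dx/(1-x)` becomes `-dt`
and `dx/x` becomes `dt/(1 - e^(-t))`, so `(-1)^r Li(1 - e^t)` is an iterated integral over positive
`t` with nonnegative kernels, and everything can be computed in `ℝ≥0∞` by Tonelli.

The remaining weight `t^k / k! · 1/(e^t - 1)` is the coefficient of `X^k` in `∑ₘ e^(-(m+1-X)t)`.
Peel off the letters of the word from the outside (`lintegral_expSum_mul_iterInt`). Exchanging the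
order of integration integrates `∑ cₘ e^(-(m+1-X)t)` from `s` to infinity, which divides `cₘ` by
`m+1-X`. Multiplying by the kernel `1/(1 - e^(-s))` then replaces coefficients by partial sums,
while the kernel `1` leaves them alone.

Hence `dx/(1-x)` raises the exponent of the current summation variable and `dx/x` opens a new one
(`foldr_letterStep_mul_invSub`). In the word itself the roles are opposite: `dx/(1-x)` opens a block
and `dx/x` prolongs it. Exchanging the two roles is Hoffman duality. Reading from the innermost
letter reverses the composition, and the innermost letter, always `dx/(1-x)`, adds `1` to the first
part (`ofFn_dualPlus`).

The outcome is the `X^k` coefficient of `∑ ∏ 1/(mᵢ - X)^Kᵢ` over `m₁ ≥ ⋯ ≥ mₙ > 0`. The negative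
binomial series turns it into the weighted sum of `ζ⋆` values. Absolute convergence of the integral
follows from finiteness of that sum. -/

namespace KanekoTsumura

open MeasureTheory Set

open scoped ENNReal

/-! ### The Hoffman dual in terms of words -/

/-- `p` is a partial sum of the list `L`. -/
def IsPartialSum (L : List ℕ) (p : ℕ) : Prop := ∃ i, (L.take i).sum = p

theorem isPartialSum_cons {e p : ℕ} {L : List ℕ} :
    IsPartialSum (e :: L) p ↔ p = 0 ∨ ∃ q, IsPartialSum L q ∧ p = e + q := by
  constructor
  · rintro ⟨i, rfl⟩
    cases i with
    | zero => simp
    | succ i => exact .inr ⟨_, ⟨i, rfl⟩, by simp⟩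
  · rintro (rfl | ⟨q, ⟨i, rfl⟩, rfl⟩)
    · exact ⟨0, by simp⟩
    · exact ⟨i + 1, by simp⟩

theorem isPartialSum_zero (L : List ℕ) : IsPartialSum L 0 := ⟨0, by simp⟩

theorem isPartialSum_sum (L : List ℕ) : IsPartialSum L L.sum := ⟨L.length, by simp⟩

theorem mem_boundaries_iff_isPartialSum {N : ℕ} (c : Composition N) (i : Fin (N + 1)) :
    i ∈ c.boundaries ↔ IsPartialSum c.blocks i := by
  simp only [Composition.boundaries, Finset.mem_map, Finset.mem_univ, true_and, IsPartialSum]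
  constructor
  · rintro ⟨j, rfl⟩
    exact ⟨j, rfl⟩
  · rintro ⟨j, hj⟩
    have hj' : c.sizeUpTo j = i := hj
    rcases lt_or_ge j (c.length + 1) with h | h
    · exact ⟨⟨j, h⟩, Fin.ext hj'⟩
    -- `take` saturates past the end of the list, so such a `j` yields the full sum `N`.
    · refine ⟨Fin.last _, Fin.ext ?_⟩
      rw [c.sizeUpTo_ofLength_le j (by omega)] at hj'
      simpa using hj'

theorem composition_ext_of_isPartialSum {N : ℕ} {c d : Composition N}
    (h : ∀ p, 0 < p → p < N → (IsPartialSum c.blocks p ↔ IsPartialSum d.blocks p)) : c = d := by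
  refine (compositionEquiv N).injective ?_
  refine CompositionAsSet.ext ?_
  change c.boundaries = d.boundaries
  ext i
  rw [mem_boundaries_iff_isPartialSum, mem_boundaries_iff_isPartialSum]
  rcases Nat.eq_zero_or_pos (i : ℕ) with h0 | h0
  · simp [h0, isPartialSum_zero]
  rcases (Nat.lt_succ_iff.1 i.2).lt_or_eq with hN | hN
  · exact h i h0 hN
  · have hc := isPartialSum_sum c.blocks
    have hd := isPartialSum_sum d.blocks
    rw [c.blocks_sum] at hc
    rw [d.blocks_sum] at hd
    simp [hN, hc, hd]

/-- Add `1` to the first entry of a list. -/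
def incHead : List ℕ → List ℕ
  | [] => []
  | e :: L => (e + 1) :: L

/-- The list of exponents `(e, e', …)` encoded by a word: `true` increases the first exponent and
`false` starts a new one. -/
def dualList : List Bool → List ℕ
  | [] => [1]
  | true :: V => incHead (dualList V)
  | false :: V => 1 :: dualList V

/-- Makes `dualList V` a composition of `V.length + 1`. The head is exhibited as a successor so that
`incHead` can be computed and positivity is visible. -/
theorem exists_dualList_eq_cons (V : List Bool) :
    ∃ e L, dualList V = (e + 1) :: L ∧ (∀ x ∈ L, 0 < x) ∧ e + L.sum = V.length := by
  induction V with
  | nil => exact ⟨0, [], rfl, by simp, by simp⟩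
  | cons x V ih =>
    obtain ⟨e, L, h, hL, hs⟩ := ih
    cases x with
    | true => exact ⟨e + 1, L, by simp [dualList, h, incHead], hL, by simp; omega⟩
    | false =>
      refine ⟨0, (e + 1) :: L, by simp [dualList, h], ?_, by simp; omega⟩
      simpa using hL

/-- Either letter shifts the positive partial sums of the tail by one. Only `false` creates the new
partial sum `1`; after `true` the head is at least `2`. -/
theorem isPartialSum_dualList (V : List Bool) {p : ℕ} (hp : p < V.length) :
    IsPartialSum (dualList V) (p + 1) ↔ V[p] = false := by
  induction V generalizing p with
  | nil => simp at hp
  | cons x V ih =>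
    obtain ⟨e, L, h, -, -⟩ := exists_dualList_eq_cons V
    cases x with
    | true =>
      have : IsPartialSum (dualList (true :: V)) (p + 1) ↔
          p ≠ 0 ∧ IsPartialSum (dualList V) p := by
        simp only [dualList, h, incHead, isPartialSum_cons]
        constructor
        · rintro (h | ⟨q, hq, h⟩)
          · omega
          · exact ⟨by omega, .inr ⟨q, hq, by omega⟩⟩
        · rintro ⟨h0, h | ⟨q, hq, h⟩⟩
          · exact absurd h h0
          · exact .inr ⟨q, hq, by omega⟩
      rw [this]
      cases p with
      | zero => simp
      | succ p => simpa using ih (by simpa using hp)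
    | false =>
      have : IsPartialSum (dualList (false :: V)) (p + 1) ↔ IsPartialSum (dualList V) p := by
        simp only [dualList]
        rw [isPartialSum_cons]
        constructor
        · rintro (h | ⟨q, hq, h⟩)
          · omega
          · rwa [show p = q by omega]
        · intro h
          exact .inr ⟨p, h, by omega⟩
      rw [this]
      cases p with
      | zero => simp [isPartialSum_zero]
      | succ p => simpa using ih (by simpa using hp)

/-- The word of the iterated integral of a multiple polylogarithm, outermost letter first; `true`
stands for `dx / (1 - x)` and `false` for `dx / x`. -/
def polylogWord (l : List ℕ) : List Bool :=
  l.flatMap fun k => List.replicate (k - 1) false ++ [true]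

/-- The word of a multiple polylogarithm with index `l.reverse`, innermost letter first. -/
def revWord (l : List ℕ) : List Bool :=
  l.flatMap fun k => true :: List.replicate (k - 1) false

theorem reverse_polylogWord (l : List ℕ) : (polylogWord l).reverse = revWord l.reverse := by
  simp [polylogWord, revWord, List.reverse_flatMap, Function.comp_def]

theorem length_revWord (l : List ℕ) (hl : ∀ x ∈ l, 0 < x) : (revWord l).length = l.sum := by
  induction l with
  | nil => rfl
  | cons k l ih =>
    have hk := hl k (by simp)
    have := ih fun x hx => hl x (by simp [hx])
    simp only [revWord, List.flatMap_cons, List.length_append, List.length_cons,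
      List.length_replicate, List.sum_cons] at this ⊢
    omega

/-- Each block begins with its only `true`, and blocks begin exactly at the partial sums. Together
with `isPartialSum_dualList`, where `false` marks the partial sums, this gives the complementarity
defining the Hoffman dual. -/
theorem getElem?_revWord (l : List ℕ) (hl : ∀ x ∈ l, 0 < x) {p : ℕ} (hp : p < l.sum) :
    (revWord l)[p]? = some true ↔ IsPartialSum l p := by
  induction l generalizing p with
  | nil => simp at hp
  | cons k l ih =>
    have hk := hl k (by simp)
    have hcons : revWord (k :: l) = (true :: List.replicate (k - 1) false) ++ revWord l := rfl
    have hlen : (true :: List.replicate (k - 1) false).length = k := by simp; omega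
    rw [hcons, isPartialSum_cons]
    rcases lt_or_ge p k with h | h
    · rw [List.getElem?_append_left (by omega)]
      cases p with
      | zero => simp
      | succ p =>
        have : ¬ ∃ q, IsPartialSum l q ∧ p + 1 = k + q := by
          rintro ⟨q, -, h⟩
          omega
        simp [this, List.getElem?_replicate]
    · rw [List.getElem?_append_right (by omega), hlen,
        ih (fun x hx => hl x (by simp [hx])) (by simp at hp; omega)]
      constructor
      · intro h'
        exact .inr ⟨_, h', by omega⟩
      · rintro (h0 | ⟨q, hq, rfl⟩)
        · omega
        · simpa using hq

/-- Write the reversed word as `true :: V`. Position `p` of `V` is position `p + 1` of the whole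
word, so `dualList V` cuts exactly where `c.reverse` does not. The leading `true` supplies the extra
`1` of `addOneFirst`. -/
theorem ofFn_dualPlus {N : ℕ} (hN : 0 < N) (c : Composition N) :
    List.ofFn (dualPlus c) = dualList (polylogWord c.blocks).reverse := by
  have hpos : ∀ x ∈ c.reverse.blocks, 0 < x := fun x hx => c.reverse.blocks_pos hx
  have hlen := length_revWord _ hpos
  rw [c.reverse.blocks_sum] at hlen
  obtain ⟨x, V, hV⟩ := List.exists_cons_of_length_pos (by omega : 0 < (revWord c.reverse.blocks).length)
  have hget : ∀ p (hp : p < N), (revWord c.reverse.blocks)[p]? = some true ↔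
      IsPartialSum c.reverse.blocks p := fun p hp =>
    getElem?_revWord _ hpos (by rwa [c.reverse.blocks_sum])
  rw [hV] at hget hlen
  -- `0` is always a partial sum, so the word begins with `true`.
  have hx : x = true := by simpa [isPartialSum_zero] using hget 0 hN
  subst hx
  obtain ⟨e, L, h, hL, hs⟩ := exists_dualList_eq_cons V
  simp only [List.length_cons] at hlen
  let d : Composition N := ⟨dualList V, by
    intro i hi
    rw [h, List.mem_cons] at hi
    rcases hi with rfl | hi
    · omega
    · exact hL i hi, by rw [h]; simp; omega⟩
  have hd : hoffmanDual c.reverse = d := by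
    refine composition_ext_of_isPartialSum fun p h0 hp => ?_
    have h1 := mem_boundaries_hoffmanDual c.reverse ⟨p, by omega⟩
      (by simp [Fin.ext_iff]; omega) (by simp [Fin.ext_iff]; omega)
    rw [mem_boundaries_iff_isPartialSum, mem_boundaries_iff_isPartialSum] at h1
    obtain ⟨q, rfl⟩ : ∃ q, p = q + 1 := ⟨p - 1, by omega⟩
    have hq : q < V.length := by omega
    have h2 := isPartialSum_dualList V hq
    have h3 := hget (q + 1) hp
    simp only [List.getElem?_cons_succ, List.getElem?_eq_getElem hq, Option.some.injEq] at h3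
    change _ ↔ IsPartialSum (dualList V) (q + 1)
    rw [h1, h2, ← Bool.not_eq_true, h3]
  have hrev : (polylogWord c.blocks).reverse = true :: V := by
    rw [reverse_polylogWord, ← hV]
    rfl
  have hinc : ∀ {n : ℕ} (f : Fin n → ℕ), List.ofFn (addOneFirst f) = incHead (List.ofFn f) := by
    intro n f
    cases n with
    | zero => simp [incHead]
    | succ n => simp [List.ofFn_succ, incHead, addOneFirst]
  rw [dualPlus, hinc, Composition.ofFn_blocksFun, hrev, hd]
  rfl

/-! ### Generating series of multiple zeta star values -/

/-- The expansion of `1 / (a - X)` in powers of `X`. -/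
noncomputable def invSub (a : ℕ) : PowerSeries ℝ≥0∞ :=
  PowerSeries.mk fun j => ((a : ℝ≥0∞)⁻¹) ^ (j + 1)

/-- Hockey-stick identity. Truncated subtraction is harmless at `K = 0`: the term `i = 0` is `1` and
the others vanish. -/
theorem sum_range_choose_add_sub_one (K j : ℕ) :
    ∑ i ∈ Finset.range (j + 1), (K + i - 1).choose i = (K + j).choose j := by
  induction j with
  | zero => simp
  | succ j ih =>
    rw [Finset.sum_range_succ, ih, show K + (j + 1) - 1 = K + j by omega,
      show K + (j + 1) = K + j + 1 by omega, Nat.choose_succ_succ]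

/-- Negative binomial series; this is where the factors of `binomProd` come from. -/
theorem coeff_invSub_pow (a K j : ℕ) :
    PowerSeries.coeff j (invSub a ^ K) =
      ((K + j - 1).choose j : ℝ≥0∞) * ((a : ℝ≥0∞)⁻¹) ^ (K + j) := by
  induction K generalizing j with
  | zero =>
    cases j with
    | zero => simp
    | succ j => simp [PowerSeries.coeff_one]
  | succ K ih =>
    rw [pow_succ, PowerSeries.coeff_mul, Finset.Nat.sum_antidiagonal_eq_sum_range_succ
      (fun i l => PowerSeries.coeff i (invSub a ^ K) * PowerSeries.coeff l (invSub a)),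
      show K + 1 + j - 1 = K + j by omega, ← sum_range_choose_add_sub_one, Nat.cast_sum,
      Finset.sum_mul]
    refine Finset.sum_congr rfl fun i hi => ?_
    have hi' : i ≤ j := by simpa [Nat.lt_succ_iff] using hi
    rw [ih, invSub, PowerSeries.coeff_mk, mul_assoc, ← pow_add]
    congr 2
    omega

/-- `∑ ∏ᵢ 1 / (mᵢ - X)^Lᵢ` over `m + 1 ≥ m₁ ≥ m₂ ≥ ⋯ > 0`, as a nested sum. -/
noncomputable def nestedSum : List ℕ → ℕ → PowerSeries ℝ≥0∞
  | [], _ => 1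
  | e :: L, m => ∑ i ∈ Finset.range (m + 1), invSub (i + 1) ^ e * nestedSum L i

theorem antitone_cons {r a : ℕ} {m : Fin r → ℕ} :
    Antitone (Fin.cons a m : Fin (r + 1) → ℕ) ↔ Antitone m ∧ ∀ i, m i ≤ a := by
  constructor
  · intro h
    exact ⟨fun i j hij => by simpa using h (Fin.succ_le_succ_iff.2 hij),
      fun i => by simpa using h (Fin.zero_le i.succ)⟩
  · rintro ⟨h1, h2⟩ i j hij
    induction j using Fin.cases with
    | zero =>
      obtain rfl : i = 0 := by simpa using hij
      exact le_rfl
    | succ j =>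
      induction i using Fin.cases with
      | zero => simpa using h2 j
      | succ i => simpa using h1 (Fin.succ_le_succ_iff.1 hij)

open Classical in
/-- The sequences `m + 1 ≥ m₁ ≥ ⋯ ≥ mₙ > 0`. -/
noncomputable def boundedStarIndex (n m : ℕ) : Finset (Fin n → ℕ) :=
  (Fintype.piFinset fun _ => Finset.Icc 1 (m + 1)).filter Antitone

theorem mem_boundedStarIndex {n m : ℕ} {x : Fin n → ℕ} :
    x ∈ boundedStarIndex n m ↔ Antitone x ∧ ∀ i, 0 < x i ∧ x i ≤ m + 1 := by
  simp [boundedStarIndex, Fintype.mem_piFinset, Finset.mem_Icc, Nat.lt_iff_add_one_le, and_comm]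

theorem nestedSum_ofFn {n : ℕ} (K : Fin n → ℕ) (m : ℕ) :
    nestedSum (List.ofFn K) m = ∑ x ∈ boundedStarIndex n m, ∏ i, invSub (x i) ^ K i := by
  induction n generalizing m with
  | zero =>
    have : boundedStarIndex 0 m = {Fin.elim0} := by
      ext x
      simp only [mem_boundedStarIndex, Finset.mem_singleton]
      exact ⟨fun _ => funext fun i => i.elim0, fun _ => ⟨fun i => i.elim0, fun i => i.elim0⟩⟩
    simp [nestedSum, this]
  | succ n ih =>
    rw [List.ofFn_succ, nestedSum]
    simp_rw [ih, Finset.mul_sum]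
    rw [Finset.sum_sigma']
    refine Finset.sum_bij' (fun p _ => (Fin.cons (p.1 + 1) p.2 : Fin (n + 1) → ℕ))
      (fun x _ => ⟨x 0 - 1, Fin.tail x⟩) ?_ ?_ ?_ ?_ ?_
    · rintro ⟨i, x⟩ h
      simp only [Finset.mem_sigma, Finset.mem_range, mem_boundedStarIndex] at h
      simp only [mem_boundedStarIndex, antitone_cons, Fin.forall_fin_succ, Fin.cons_zero,
        Fin.cons_succ]
      exact ⟨⟨h.2.1, fun j => (h.2.2 j).2⟩, by omega,
        fun j => ⟨(h.2.2 j).1, (h.2.2 j).2.trans (by omega)⟩⟩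
    · intro x h
      rw [mem_boundedStarIndex] at h
      have h0 := h.2 0
      simp only [Finset.mem_sigma, Finset.mem_range, mem_boundedStarIndex]
      refine ⟨by omega, fun i j hij => h.1 (Fin.succ_le_succ_iff.2 hij), fun i =>
        ⟨(h.2 _).1, ?_⟩⟩
      have := h.1 (Fin.zero_le i.succ)
      change x i.succ ≤ _
      omega
    · rintro ⟨i, x⟩ h
      simp
    · intro x h
      rw [mem_boundedStarIndex] at h
      have h0 := h.2 0
      rw [Nat.sub_add_cancel h0.1]
      exact Fin.cons_self_tail x
    · rintro ⟨i, x⟩ h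
      rw [Fin.prod_univ_succ]
      simp

/-- Splitting off the first entry of a star index. -/
noncomputable def starIndexEquiv (n : ℕ) :
    StarIndex (n + 1) ≃ Σ m : ℕ, {x : Fin n → ℕ // x ∈ boundedStarIndex n m} where
  toFun x := ⟨x.1 0 - 1, Fin.tail x.1, by
    rw [mem_boundedStarIndex]
    refine ⟨fun i j hij => x.2.1 (Fin.succ_le_succ_iff.2 hij), fun i => ⟨x.2.2 _, ?_⟩⟩
    have := x.2.1 (Fin.zero_le i.succ)
    change x.1 i.succ ≤ _
    omega⟩
  invFun p := ⟨Fin.cons (p.1 + 1) p.2.1, by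
    have h := mem_boundedStarIndex.1 p.2.2
    refine ⟨antitone_cons.2 ⟨h.1, fun i => (h.2 i).2⟩, ?_⟩
    simp only [Fin.forall_fin_succ, Fin.cons_zero, Fin.cons_succ]
    exact ⟨by omega, fun i => (h.2 i).1⟩⟩
  left_inv x := by
    refine Subtype.ext ?_
    simp only [Nat.sub_add_cancel (x.2.2 0)]
    exact Fin.cons_self_tail x.1
  right_inv p := by
    rfl

theorem tsum_starIndex_succ {n : ℕ} (g : (Fin (n + 1) → ℕ) → ℝ≥0∞) :
    ∑' x : StarIndex (n + 1), g x.1 =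
      ∑' m : ℕ, ∑ x ∈ boundedStarIndex n m, g (Fin.cons (m + 1) x) := by
  rw [← (starIndexEquiv n).symm.tsum_eq, ENNReal.tsum_sigma']
  refine tsum_congr fun m => ?_
  exact Finset.tsum_subtype (boundedStarIndex n m) fun x => g (Fin.cons (m + 1) x)

/-- The head exponent is kept apart because only the largest variable ranges over an infinite set;
it bounds all the others. -/
theorem tsum_coeff_nestedSum {n : ℕ} (K : Fin n → ℕ) {e : ℕ} {L : List ℕ}
    (h : List.ofFn K = e :: L) (k : ℕ) :
    ∑' m : ℕ, PowerSeries.coeff k (invSub (m + 1) ^ e * nestedSum L m) =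
      ∑' x : StarIndex n, PowerSeries.coeff k (∏ i, invSub (x.1 i) ^ K i) := by
  cases n with
  | zero => simp at h
  | succ n =>
    rw [List.ofFn_succ, List.cons.injEq] at h
    obtain ⟨rfl, rfl⟩ := h
    rw [tsum_starIndex_succ fun x => PowerSeries.coeff k (∏ i, invSub (x i) ^ K i)]
    refine tsum_congr fun m => ?_
    rw [nestedSum_ofFn, Finset.mul_sum, map_sum]
    refine Finset.sum_congr rfl fun x _ => ?_
    rw [Fin.prod_univ_succ]
    simp

theorem coeff_prod_invSub {n : ℕ} (K x : Fin n → ℕ) (hx : ∀ i, 0 < x i) (k : ℕ) :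
    PowerSeries.coeff k (∏ i, invSub (x i) ^ K i) =
      ∑ j ∈ Finset.Nat.antidiagonalTuple n k,
        (binomProd K j : ℝ≥0∞) * ENNReal.ofReal (zetaTerm (K + j) x) := by
  classical
  rw [PowerSeries.coeff_prod]
  refine Finset.sum_nbij' (fun l => ⇑l) (fun j => Finsupp.equivFunOnFinite.symm j) ?_ ?_ ?_ ?_ ?_
  · intro l hl
    rw [Finset.mem_finsuppAntidiag] at hl
    rw [Finset.Nat.mem_antidiagonalTuple]
    exact hl.1
  · intro j hj
    rw [Finset.Nat.mem_antidiagonalTuple] at hj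
    rw [Finset.mem_finsuppAntidiag]
    exact ⟨by simpa using hj, Finset.subset_univ _⟩
  · intro l _
    ext i
    simp
  · intro j _
    rfl
  · intro l _
    rw [binomProd, zetaTerm, ENNReal.ofReal_prod_of_nonneg fun _ _ => by positivity,
      Nat.cast_prod, ← Finset.prod_mul_distrib]
    refine Finset.prod_congr rfl fun i _ => ?_
    rw [coeff_invSub_pow, Pi.add_apply, one_div, ENNReal.ofReal_inv_of_pos
      (pow_pos (Nat.cast_pos.2 (hx i)) _), ENNReal.ofReal_pow (Nat.cast_nonneg _),
      ENNReal.ofReal_natCast, ENNReal.inv_pow]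

/-! ### Absolute convergence of the multiple zeta star series -/

theorem summable_prod_fin (a : ℕ → ℝ) (ha : ∀ m, 0 ≤ a m) (hs : Summable a) (n : ℕ) :
    Summable fun m : Fin n → ℕ => ∏ i, a (m i) := by
  suffices h : HasSum (fun m : Fin n → ℕ => ∏ i, a (m i)) ((∑' m, a m) ^ n) from h.summable
  induction n with
  | zero => simp
  | succ n ih =>
    refine hasSum_cons (c := a) (g := fun _ m => ∏ i, a (m i)) (S := fun _ => (∑' m, a m) ^ n)
      (fun b m => by rw [Fin.prod_univ_succ]; simp)
      (fun _ m => Finset.prod_nonneg fun i _ => ha _) (fun _ => ih) ?_ ?_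
    · simpa [abs_of_nonneg (ha _)] using hs.mul_right _
    · rw [pow_succ']
      exact hs.hasSum.mul_right _

/-- The surplus power of the largest variable is shared equally among all `n`. With `p = 1 + 1/n`,
`∏ xᵢ^p = ∏ xᵢ · ∏ xᵢ^(1/n)` is at most `x₁ ∏ xᵢ`, hence at most `∏ xᵢ^Kᵢ`, and a product of `n`
convergent `p`-series dominates. -/
theorem summable_zetaTerm {n : ℕ} (K : Fin n → ℕ) (hpos : ∀ i, 0 < K i)
    (htwo : ∀ i : Fin n, (i : ℕ) = 0 → 2 ≤ K i) :
    Summable fun x : StarIndex n => zetaTerm K x.1 := by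
  cases n with
  | zero =>
    have : Finite (StarIndex 0) := inferInstance
    exact Summable.of_finite
  | succ n =>
    have hn : (0 : ℝ) < (n + 1 : ℕ) := by positivity
    set p : ℝ := 1 + ((n + 1 : ℕ) : ℝ)⁻¹ with hp
    have hs : Summable fun m : ℕ => 1 / (m : ℝ) ^ p :=
      Real.summable_one_div_nat_rpow.2 (by rw [hp]; simpa using hn)
    have hsum := (summable_prod_fin _ (fun m => by positivity) hs (n + 1)).comp_injective
      (Subtype.val_injective (p := fun m : Fin (n + 1) → ℕ => Antitone m ∧ ∀ i, 0 < m i))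
    refine Summable.of_nonneg_of_le (fun x => zetaTerm_nonneg _ _) (fun x => ?_) hsum
    obtain ⟨x, hanti, hx⟩ := x
    have hx1 : ∀ i, (1 : ℝ) ≤ x i := fun i => by exact_mod_cast hx i
    have hx0 : ∀ i, (0 : ℝ) < x i := fun i => zero_lt_one.trans_le (hx1 i)
    simp only [Function.comp_apply, zetaTerm, one_div]
    rw [Finset.prod_inv_distrib, Finset.prod_inv_distrib]
    refine inv_anti₀ (Finset.prod_pos fun i _ => Real.rpow_pos_of_pos (hx0 i) _) ?_
    have h1 : ∏ i, (x i : ℝ) ^ p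
        = (∏ i, (x i : ℝ)) * ∏ i, (x i : ℝ) ^ (((n + 1 : ℕ) : ℝ)⁻¹) := by
      rw [← Finset.prod_mul_distrib]
      refine Finset.prod_congr rfl fun i _ => ?_
      rw [hp, Real.rpow_add (hx0 i), Real.rpow_one]
    have h2 : ∏ i, (x i : ℝ) ^ (((n + 1 : ℕ) : ℝ)⁻¹) ≤ x 0 := by
      calc ∏ i, (x i : ℝ) ^ (((n + 1 : ℕ) : ℝ)⁻¹)
          ≤ ∏ _i : Fin (n + 1), (x 0 : ℝ) ^ (((n + 1 : ℕ) : ℝ)⁻¹) :=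
            Finset.prod_le_prod (fun i _ => (Real.rpow_pos_of_pos (hx0 i) _).le) fun i _ =>
              Real.rpow_le_rpow (hx0 i).le (by exact_mod_cast hanti (Fin.zero_le i))
                (by positivity)
        _ = x 0 := by
            rw [Finset.prod_const, Finset.card_univ, Fintype.card_fin,
              Real.rpow_inv_natCast_pow (hx0 0).le (by omega)]
    rw [h1, Fin.prod_univ_succ, Fin.prod_univ_succ fun i => (x i : ℝ) ^ K i]
    have h3 : ∏ i : Fin n, (x i.succ : ℝ) ≤ ∏ i : Fin n, (x i.succ : ℝ) ^ K i.succ :=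
      Finset.prod_le_prod (fun i _ => (hx0 _).le) fun i _ =>
        le_self_pow₀ (hx1 _) (hpos _).ne'
    have h4 : (x 0 : ℝ) * x 0 ≤ (x 0 : ℝ) ^ K 0 := by
      rw [← sq]
      exact pow_le_pow_right₀ (hx1 0) (htwo 0 rfl)
    have h5 : 0 ≤ ∏ i : Fin n, (x i.succ : ℝ) := Finset.prod_nonneg fun i _ => (hx0 _).le
    calc (x 0 : ℝ) * (∏ i : Fin n, (x i.succ : ℝ)) * ∏ i, (x i : ℝ) ^ (((n + 1 : ℕ) : ℝ)⁻¹)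
        ≤ (x 0 : ℝ) * (∏ i : Fin n, (x i.succ : ℝ)) * x 0 :=
          mul_le_mul_of_nonneg_left h2 (mul_nonneg (hx0 0).le h5)
      _ = (x 0 : ℝ) * x 0 * ∏ i : Fin n, (x i.succ : ℝ) := by ring
      _ ≤ _ := mul_le_mul h4 h3 h5 (by positivity)

theorem zetaStar_nonneg {n : ℕ} (K : Fin n → ℕ) : 0 ≤ zetaStar K :=
  tsum_nonneg fun _ => zetaTerm_nonneg _ _

theorem tsum_coeff_prod_invSub {n : ℕ} (K : Fin n → ℕ) (k : ℕ)
    (hs : ∀ j ∈ Finset.Nat.antidiagonalTuple n k,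
      Summable fun x : StarIndex n => zetaTerm (K + j) x.1) :
    ∑' x : StarIndex n, PowerSeries.coeff k (∏ i, invSub (x.1 i) ^ K i) =
      ENNReal.ofReal (∑ j ∈ Finset.Nat.antidiagonalTuple n k,
        (binomProd K j : ℝ) * zetaStar (K + j)) := by
  rw [ENNReal.ofReal_sum_of_nonneg fun j _ =>
    mul_nonneg (Nat.cast_nonneg _) (zetaStar_nonneg _)]
  simp_rw [fun x : StarIndex n => coeff_prod_invSub K x.1 x.2.2 k]
  rw [Summable.tsum_finsetSum fun _ _ => ENNReal.summable]
  refine Finset.sum_congr rfl fun j hj => ?_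
  rw [ENNReal.tsum_mul_left, ENNReal.ofReal_mul (Nat.cast_nonneg _), ENNReal.ofReal_natCast,
    zetaStar, ENNReal.ofReal_tsum_of_nonneg (fun x => zetaTerm_nonneg _ _) (hs j hj)]

/-- Replace the coefficients `c` of `∑ cₘ e^(-(m + 1) t)` according to a letter of a word. -/
noncomputable def letterStep : Bool → (ℕ → PowerSeries ℝ≥0∞) → ℕ → PowerSeries ℝ≥0∞
  | true, c, m => c m * invSub (m + 1)
  | false, c, m => ∑ i ∈ Finset.range (m + 1), c i * invSub (i + 1)

/-- The extra factor `invSub (m + 1)` comes from the last integration and accounts for the exponent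
`1` with which `dualList` starts. With it included, `true` is one more power of the largest
variable, and `false` sums that variable up to a new one of exponent `1`. -/
theorem foldr_letterStep_mul_invSub (V : List Bool) {e : ℕ} {L : List ℕ}
    (h : dualList V = e :: L) (m : ℕ) :
    V.foldr letterStep (fun _ => 1) m * invSub (m + 1) =
      invSub (m + 1) ^ e * nestedSum L m := by
  induction V generalizing e L m with
  | nil =>
    simp only [dualList, List.cons.injEq] at h
    obtain ⟨rfl, rfl⟩ := h
    simp [nestedSum]
  | cons x V ih =>
    obtain ⟨f, M, hV, -, -⟩ := exists_dualList_eq_cons V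
    cases x with
    | true =>
      simp only [dualList, hV, incHead, List.cons.injEq] at h
      obtain ⟨rfl, rfl⟩ := h
      rw [List.foldr_cons, letterStep, ih hV]
      ring
    | false =>
      simp only [dualList, hV, List.cons.injEq] at h
      obtain ⟨rfl, rfl⟩ := h
      rw [List.foldr_cons, letterStep, nestedSum, mul_comm, pow_one]
      congr 1
      exact Finset.sum_congr rfl fun i _ => ih hV i

/-! ### Iterated integrals against exponentials -/

/-- `e^(-t)`. -/
noncomputable def expNeg (t : ℝ) : ℝ≥0∞ := ENNReal.ofReal (Real.exp (-t))

/-- The expansion of `e^(t X)` in powers of `X`. -/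
noncomputable def expSeries (t : ℝ) : PowerSeries ℝ≥0∞ :=
  PowerSeries.mk fun j => ENNReal.ofReal (t ^ j / j.factorial)

/-- The densities `1` and `1 / (1 - e^(-t))`: the forms `-dx / (1 - x)` and `dx / x` pulled back
along `x = 1 - e^t`. -/
noncomputable def letterKernel : Bool → ℝ → ℝ≥0∞
  | true, _ => 1
  | false, t => (1 - expNeg t)⁻¹

/-- The iterated integral of a word, outermost letter first. -/
noncomputable def iterInt : List Bool → ℝ → ℝ≥0∞
  | [], _ => 1
  | x :: W, t => ∫⁻ s in Ioo 0 t, letterKernel x s * iterInt W s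

theorem measurable_expNeg : Measurable expNeg := by
  unfold expNeg
  fun_prop

theorem measurable_letterKernel (x : Bool) : Measurable (letterKernel x) := by
  cases x with
  | true => exact measurable_const
  | false => exact (measurable_const.sub measurable_expNeg).inv

theorem measurable_iterInt (W : List Bool) : Measurable (iterInt W) := by
  cases W with
  | nil => exact measurable_const
  | cons x W =>
    -- The integrand is nonnegative, so the integral increases with its upper limit.
    refine Monotone.measurable fun s t hst => ?_
    exact lintegral_mono_set (Ioo_subset_Ioo_right hst)

/-- Tonelli on the region `0 < s < t`. -/
theorem lintegral_mul_lintegral_Ioo {G v : ℝ → ℝ≥0∞} (hG : Measurable G) (hv : Measurable v) :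
    ∫⁻ t in Ioi (0 : ℝ), G t * ∫⁻ s in Ioo 0 t, v s =
      ∫⁻ s in Ioi (0 : ℝ), (∫⁻ t in Ioi s, G t) * v s := by
  have hset : MeasurableSet {p : ℝ × ℝ | p.2 < p.1} := measurableSet_lt measurable_snd measurable_fst
  let F : ℝ → ℝ → ℝ≥0∞ := fun t s => {p : ℝ × ℝ | p.2 < p.1}.indicator (fun p => G p.1 * v p.2) (t, s)
  have hF : Measurable (Function.uncurry F) :=
    ((hG.comp measurable_fst).mul (hv.comp measurable_snd)).indicator hset
  have h1 : ∀ t : ℝ, G t * ∫⁻ s in Ioo 0 t, v s = ∫⁻ s in Ioi (0 : ℝ), F t s := by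
    intro t
    have : ∀ s, F t s = G t * (Iio t).indicator v s := by
      intro s
      by_cases h : s < t <;> simp [F, indicator, h]
    simp_rw [this]
    rw [lintegral_const_mul _ (hv.indicator measurableSet_Iio),
      setLIntegral_indicator measurableSet_Iio]
    congr 3
    rw [inter_comm]
    rfl
  have h2 : ∀ s ∈ Ioi (0 : ℝ), (∫⁻ t in Ioi s, G t) * v s = ∫⁻ t in Ioi (0 : ℝ), F t s := by
    intro s hs
    have : ∀ t, F t s = (Ioi s).indicator G t * v s := by
      intro t
      by_cases h : s < t <;> simp [F, indicator, h]
    simp_rw [this]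
    rw [lintegral_mul_const _ (hG.indicator measurableSet_Ioi),
      setLIntegral_indicator measurableSet_Ioi,
      inter_eq_self_of_subset_left (Ioi_subset_Ioi (le_of_lt hs))]
  simp_rw [h1]
  rw [lintegral_lintegral_swap hF.aemeasurable]
  exact (setLIntegral_congr_fun measurableSet_Ioi h2).symm

/-- `e^(M t) ∫ₜ^∞ s^j / j! e^(-M s) ds`. -/
noncomputable def gammaTail (M : ℝ) (j : ℕ) (t : ℝ) : ℝ :=
  ∑ p ∈ Finset.HasAntidiagonal.antidiagonal j, t ^ p.1 / p.1.factorial * M⁻¹ ^ (p.2 + 1)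

theorem gammaTail_zero (M t : ℝ) : gammaTail M 0 t = M⁻¹ := by
  simp [gammaTail]

theorem gammaTail_succ (M : ℝ) (j : ℕ) (t : ℝ) :
    gammaTail M (j + 1) t = M⁻¹ * (t ^ (j + 1) / (j + 1).factorial + gammaTail M j t) := by
  rw [gammaTail, Finset.Nat.sum_antidiagonal_succ', gammaTail, mul_add, Finset.mul_sum]
  congr 1
  · ring
  · exact Finset.sum_congr rfl fun p _ => by ring

theorem gammaTail_nonneg {M : ℝ} (hM : 0 < M) (j : ℕ) {t : ℝ} (ht : 0 ≤ t) :
    0 ≤ gammaTail M j t :=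
  Finset.sum_nonneg fun _ _ => by positivity

/-- The recursion `gammaTail_succ` is one integration by parts, so in the induction on `j` the
lower-order terms cancel. -/
theorem hasDerivAt_gammaTail {M : ℝ} (hM : 0 < M) (j : ℕ) (t : ℝ) :
    HasDerivAt (fun t => -(gammaTail M j t * Real.exp (-M * t)))
      (t ^ j / j.factorial * Real.exp (-M * t)) t := by
  have he : HasDerivAt (fun t => Real.exp (-M * t)) (Real.exp (-M * t) * -M) t := by
    simpa using ((hasDerivAt_id t).const_mul (-M)).exp
  induction j with
  | zero =>
    simp only [gammaTail_zero]
    refine (he.const_mul M⁻¹).neg.congr_deriv ?_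
    have := hM.ne'
    simp
    field_simp
  | succ j ih =>
    have hp : HasDerivAt (fun t : ℝ => t ^ (j + 1) / (j + 1).factorial) (t ^ j / j.factorial) t := by
      refine ((hasDerivAt_pow (j + 1) t).div_const _).congr_deriv ?_
      rw [Nat.factorial_succ]
      push_cast
      have : (j.factorial : ℝ) ≠ 0 := by positivity
      have : (j + 1 : ℝ) ≠ 0 := by positivity
      field_simp
    have := ((hp.mul he).neg.add ih).const_mul M⁻¹
    refine (this.congr_of_eventuallyEq (Filter.Eventually.of_forall fun s => ?_)).congr_deriv ?_
    · simp only [gammaTail_succ, Pi.add_apply, Pi.neg_apply, Pi.mul_apply]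
      ring
    · have := hM.ne'
      field_simp
      ring

theorem tendsto_gammaTail {M : ℝ} (hM : 0 < M) (j : ℕ) :
    Filter.Tendsto (fun t => -(gammaTail M j t * Real.exp (-M * t))) Filter.atTop (nhds 0) := by
  have h : ∀ n : ℕ, Filter.Tendsto (fun t : ℝ => t ^ n * Real.exp (-M * t)) Filter.atTop (nhds 0) := by
    intro n
    simpa using tendsto_rpow_mul_exp_neg_mul_atTop_nhds_zero n M hM
  have h2 : ∀ t, -(gammaTail M j t * Real.exp (-M * t)) = ∑ p ∈ Finset.HasAntidiagonal.antidiagonal j,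
      -(M⁻¹ ^ (p.2 + 1) / p.1.factorial) * (t ^ p.1 * Real.exp (-M * t)) := by
    intro t
    rw [gammaTail, Finset.sum_mul, ← Finset.sum_neg_distrib]
    exact Finset.sum_congr rfl fun p _ => by ring
  simp_rw [h2]
  have := tendsto_finsetSum (Finset.HasAntidiagonal.antidiagonal j) fun (p : ℕ × ℕ) _ =>
    (h p.1).const_mul (-(M⁻¹ ^ (p.2 + 1) / p.1.factorial))
  simpa using this

theorem lintegral_Ioi_pow_mul_exp {M : ℝ} (hM : 0 < M) (j : ℕ) {s : ℝ} (hs : 0 ≤ s) :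
    ∫⁻ t in Ioi s, ENNReal.ofReal (t ^ j / j.factorial * Real.exp (-M * t)) =
      ENNReal.ofReal (gammaTail M j s * Real.exp (-M * s)) := by
  have hpos : ∀ t ∈ Ioi s, 0 ≤ t ^ j / j.factorial * Real.exp (-M * t) := by
    intro t ht
    have : 0 ≤ t := hs.trans (le_of_lt ht)
    positivity
  have hd := fun t (_ : t ∈ Ici s) => hasDerivAt_gammaTail hM j t
  have h1 := integral_Ioi_of_hasDerivAt_of_nonneg' hd hpos (tendsto_gammaTail hM j)
  have h2 := integrableOn_Ioi_deriv_of_nonneg' hd hpos (tendsto_gammaTail hM j)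
  rw [← ofReal_integral_eq_lintegral_ofReal h2
    ((ae_restrict_iff' measurableSet_Ioi).2 (Filter.Eventually.of_forall hpos)), h1]
  simp

theorem expNeg_pow (t : ℝ) (m : ℕ) :
    expNeg t ^ (m + 1) = ENNReal.ofReal (Real.exp (-((m + 1 : ℕ) : ℝ) * t)) := by
  rw [expNeg, ← ENNReal.ofReal_pow (Real.exp_pos _).le, ← Real.exp_nat_mul]
  congr 2
  ring

/-- Coefficientwise form of `∫ₛ^∞ e^(-(m+1-X)t) dt = e^(-(m+1-X)s) / (m+1-X)`. -/
theorem lintegral_coeff_expSeries (m j : ℕ) {s : ℝ} (hs : 0 ≤ s) :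
    ∫⁻ t in Ioi s, PowerSeries.coeff j (expSeries t) * expNeg t ^ (m + 1) =
      PowerSeries.coeff j (invSub (m + 1) * expSeries s) * expNeg s ^ (m + 1) := by
  have hM : (0 : ℝ) < (m + 1 : ℕ) := by positivity
  have h1 : ∀ t ∈ Ioi s, PowerSeries.coeff j (expSeries t) * expNeg t ^ (m + 1) =
      ENNReal.ofReal (t ^ j / j.factorial * Real.exp (-((m + 1 : ℕ) : ℝ) * t)) := by
    intro t ht
    have : 0 ≤ t := hs.trans (le_of_lt ht)
    rw [expNeg_pow, expSeries, PowerSeries.coeff_mk, ENNReal.ofReal_mul (by positivity)]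
  rw [setLIntegral_congr_fun measurableSet_Ioi h1, lintegral_Ioi_pow_mul_exp hM j hs,
    ENNReal.ofReal_mul (gammaTail_nonneg hM j hs), ← expNeg_pow, mul_comm (invSub _),
    PowerSeries.coeff_mul, gammaTail,
    ENNReal.ofReal_sum_of_nonneg fun p _ => by positivity]
  congr 1
  refine Finset.sum_congr rfl fun p _ => ?_
  rw [expSeries, invSub, PowerSeries.coeff_mk, PowerSeries.coeff_mk,
    ENNReal.ofReal_mul (by positivity), ENNReal.ofReal_pow (by positivity),
    ENNReal.ofReal_inv_of_pos hM, ENNReal.ofReal_natCast]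

theorem measurable_coeff_expSeries (j : ℕ) :
    Measurable fun t => PowerSeries.coeff j (expSeries t) := by
  simp only [expSeries, PowerSeries.coeff_mk]
  fun_prop

theorem measurable_coeff_mul_expSeries (c : PowerSeries ℝ≥0∞) (k m : ℕ) :
    Measurable fun t => PowerSeries.coeff k (c * expSeries t) * expNeg t ^ m := by
  simp_rw [PowerSeries.coeff_mul]
  exact (Finset.measurable_fun_sum _ fun p _ =>
    (measurable_coeff_expSeries p.2).const_mul _).mul (measurable_expNeg.pow_const m)

theorem lintegral_coeff_mul_expSeries (c : PowerSeries ℝ≥0∞) (k m : ℕ) {s : ℝ} (hs : 0 ≤ s) :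
    ∫⁻ t in Ioi s, PowerSeries.coeff k (c * expSeries t) * expNeg t ^ (m + 1) =
      PowerSeries.coeff k (c * invSub (m + 1) * expSeries s) * expNeg s ^ (m + 1) := by
  rw [mul_assoc c]
  simp_rw [PowerSeries.coeff_mul _ c, Finset.sum_mul]
  rw [lintegral_finsetSum _ fun p _ => ((measurable_coeff_expSeries p.2).const_mul _).mul
    (measurable_expNeg.pow_const _)]
  refine Finset.sum_congr rfl fun p _ => ?_
  simp_rw [mul_assoc]
  rw [lintegral_const_mul (PowerSeries.coeff p.1 c)
    (f := fun t => PowerSeries.coeff p.2 (expSeries t) * expNeg t ^ (m + 1))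
    ((measurable_coeff_expSeries p.2).mul (measurable_expNeg.pow_const _)),
    lintegral_coeff_expSeries m _ hs]

/-- The coefficient of `X^k` in `∑ₘ cₘ e^(-(m + 1 - X) t)`. -/
noncomputable def expSum (c : ℕ → PowerSeries ℝ≥0∞) (k : ℕ) (t : ℝ) : ℝ≥0∞ :=
  ∑' m : ℕ, PowerSeries.coeff k (c m * expSeries t) * expNeg t ^ (m + 1)

theorem measurable_expSum (c : ℕ → PowerSeries ℝ≥0∞) (k : ℕ) : Measurable (expSum c k) :=
  Measurable.tsum fun m => measurable_coeff_mul_expSeries (c m) k (m + 1)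

theorem lintegral_expSum (c : ℕ → PowerSeries ℝ≥0∞) (k : ℕ) {s : ℝ} (hs : 0 ≤ s) :
    ∫⁻ t in Ioi s, expSum c k t = expSum (fun m => c m * invSub (m + 1)) k s := by
  unfold expSum
  rw [lintegral_tsum fun m => (measurable_coeff_mul_expSeries (c m) k (m + 1)).aemeasurable]
  exact tsum_congr fun m => lintegral_coeff_mul_expSeries (c m) k m hs

/-- Cauchy product with the geometric series; in `ℝ≥0∞` no convergence condition on `q` is needed.
-/
theorem tsum_geometric_mul_tsum (a : ℕ → ℝ≥0∞) (q : ℝ≥0∞) :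
    (1 - q)⁻¹ * ∑' m, a m * q ^ (m + 1) =
      ∑' m, (∑ i ∈ Finset.range (m + 1), a i) * q ^ (m + 1) := by
  rw [← ENNReal.tsum_geometric, mul_comm, ← ENNReal.tsum_mul_right]
  simp_rw [← ENNReal.tsum_mul_left]
  rw [← ENNReal.tsum_prod (f := fun i l => a i * q ^ (i + 1) * q ^ l),
    ← Finset.HasAntidiagonal.sigmaAntidiagonalEquivProd.tsum_eq, ENNReal.tsum_sigma']
  refine tsum_congr fun m => ?_
  simp only [Finset.HasAntidiagonal.sigmaAntidiagonalEquivProd_apply]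
  rw [Finset.tsum_subtype (Finset.HasAntidiagonal.antidiagonal m) fun p => a p.1 * q ^ (p.1 + 1) * q ^ p.2,
    Finset.sum_mul, Finset.Nat.sum_antidiagonal_eq_sum_range_succ
    (fun i l => a i * q ^ (i + 1) * q ^ l)]
  refine Finset.sum_congr rfl fun i hi => ?_
  have : i ≤ m := by simpa [Nat.lt_succ_iff] using hi
  rw [mul_assoc, ← pow_add]
  congr 2
  omega

theorem letterKernel_mul_expSum (x : Bool) (c : ℕ → PowerSeries ℝ≥0∞) (k : ℕ) (s : ℝ) :
    letterKernel x s * expSum (fun m => c m * invSub (m + 1)) k s =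
      expSum (letterStep x c) k s := by
  cases x with
  | true => simp [letterKernel, expSum, letterStep]
  | false =>
    rw [letterKernel, expSum, tsum_geometric_mul_tsum]
    refine tsum_congr fun m => ?_
    rw [letterStep, Finset.sum_mul, Finset.sum_mul, map_sum, Finset.sum_mul]

/-- Each outermost letter is absorbed into the coefficients, so the induction must allow arbitrary
`c`. The outermost letter acts first and the innermost last, whence the reversal under `foldr`. -/
theorem lintegral_expSum_mul_iterInt (W : List Bool) (c : ℕ → PowerSeries ℝ≥0∞) (k : ℕ) :
    ∫⁻ t in Ioi (0 : ℝ), expSum c k t * iterInt W t =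
      ∑' m : ℕ, PowerSeries.coeff k (W.reverse.foldr letterStep c m * invSub (m + 1)) := by
  induction W generalizing c with
  | nil =>
    have h1 : expSeries 0 = 1 := by
      ext j
      cases j <;> simp [expSeries, PowerSeries.coeff_one]
    have h2 : expNeg 0 = 1 := by simp [expNeg]
    simp only [iterInt, mul_one]
    rw [lintegral_expSum c k le_rfl]
    simp [expSum, h1, h2]
  | cons x W ih =>
    simp only [iterInt]
    rw [lintegral_mul_lintegral_Ioo (v := fun s => letterKernel x s * iterInt W s)
      (measurable_expSum c k) ((measurable_letterKernel x).mul (measurable_iterInt W))]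
    have h : ∀ s ∈ Ioi (0 : ℝ), (∫⁻ t in Ioi s, expSum c k t) * (letterKernel x s * iterInt W s) =
        expSum (letterStep x c) k s * iterInt W s := by
      intro s hs
      rw [lintegral_expSum c k (le_of_lt hs), ← letterKernel_mul_expSum]
      ring
    rw [setLIntegral_congr_fun measurableSet_Ioi h, ih]
    simp

theorem expSum_one (k : ℕ) {t : ℝ} (ht : 0 < t) :
    expSum (fun _ => 1) k t = ENNReal.ofReal (t ^ k / k.factorial * (Real.exp t - 1)⁻¹) := by
  have hq : Real.exp (-t) < 1 := by simpa using ht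
  have hpos : 0 < Real.exp t - 1 := by simpa using ht
  simp only [expSum, one_mul]
  rw [ENNReal.tsum_mul_left, ENNReal.tsum_geometric_add_one, expSeries, PowerSeries.coeff_mk,
    ENNReal.ofReal_mul (by positivity), expNeg, ← ENNReal.ofReal_one,
    ← ENNReal.ofReal_sub _ (Real.exp_pos _).le, ← ENNReal.ofReal_inv_of_pos (by linarith),
    ← ENNReal.ofReal_mul (Real.exp_pos _).le]
  congr 2
  have : 1 - Real.exp (-t) ≠ 0 := by linarith
  rw [eq_comm, inv_eq_iff_eq_inv, mul_inv, inv_inv, ← Real.exp_neg, neg_neg, mul_sub, ← Real.exp_add]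
  simp

/-! ### Multiple polylogarithms as iterated integrals -/

theorem image_one_sub_exp_Ioo (t : ℝ) :
    (fun s => 1 - Real.exp s) '' Ioo 0 t = Ioo (1 - Real.exp t) 0 := by
  ext x
  constructor
  · rintro ⟨s, hs, rfl⟩
    have h1 := Real.exp_lt_exp.2 hs.1
    have h2 := Real.exp_lt_exp.2 hs.2
    rw [Real.exp_zero] at h1
    exact ⟨by simpa using h2, by simpa using hs.1⟩
  · rintro ⟨h1, h2⟩
    have h3 : 0 < 1 - x := by linarith
    refine ⟨Real.log (1 - x), ⟨Real.log_pos (by linarith), ?_⟩, ?_⟩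
    · rw [Real.log_lt_iff_lt_exp h3]
      linarith
    · simp [Real.exp_log h3]

/-- The endpoint `1 - e^t` lies left of `0`, so the path runs backwards and `σ` becomes `-σ`.
Nonnegativity is carried along because `ENNReal.ofReal` forgets negative values. -/
theorem integral_comp_one_sub_exp {φ : ℝ → ℝ} {σ : ℝ} {v : ℝ → ℝ≥0∞} {t : ℝ} (ht : 0 < t)
    (hint : IntervalIntegrable φ volume 0 (1 - Real.exp t))
    (hφ : ∀ s, 0 < s → 0 ≤ σ * φ (1 - Real.exp s) ∧
      ENNReal.ofReal (Real.exp s * (σ * φ (1 - Real.exp s))) = v s) :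
    0 ≤ -σ * ∫ x in (0 : ℝ)..(1 - Real.exp t), φ x ∧
      ENNReal.ofReal (-σ * ∫ x in (0 : ℝ)..(1 - Real.exp t), φ x) = ∫⁻ s in Ioo 0 t, v s := by
  have hx : 1 - Real.exp t ≤ 0 := by simpa using ht.le
  have h1 : -σ * ∫ x in (0 : ℝ)..(1 - Real.exp t), φ x
      = ∫ x in Ioo (1 - Real.exp t) 0, σ * φ x := by
    rw [intervalIntegral.integral_of_ge hx, integral_Ioc_eq_integral_Ioo, integral_const_mul]
    ring
  have hint' : IntegrableOn (fun x => σ * φ x) (Ioo (1 - Real.exp t) 0) :=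
    (((intervalIntegrable_iff_integrableOn_Ioo_of_le hx).1 hint.symm)).const_mul σ
  have hpos : ∀ x ∈ Ioo (1 - Real.exp t) 0, 0 ≤ σ * φ x := by
    intro x hx
    rw [← image_one_sub_exp_Ioo] at hx
    obtain ⟨s, hs, rfl⟩ := hx
    exact (hφ s hs.1).1
  rw [h1]
  refine ⟨setIntegral_nonneg measurableSet_Ioo hpos, ?_⟩
  rw [ofReal_integral_eq_lintegral_ofReal hint'
    ((ae_restrict_iff' measurableSet_Ioo).2 (Filter.Eventually.of_forall hpos)),
    ← image_one_sub_exp_Ioo, lintegral_image_eq_lintegral_abs_deriv_mul measurableSet_Ioo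
      (f' := fun s => -Real.exp s)
      (fun s _ => ((Real.hasDerivAt_exp s).const_sub 1).hasDerivWithinAt)
      (fun a _ b _ h => by simpa using h)]
  refine setLIntegral_congr_fun measurableSet_Ioo fun s hs => ?_
  rw [abs_neg, abs_of_pos (Real.exp_pos s), ← ENNReal.ofReal_mul (Real.exp_pos s).le]
  exact (hφ s hs.1).2

/-- Along `x = 1 - e^t`, `t > 0`, the function `h` is up to the sign `ε` the iterated integral of
the word `W`. -/
def RepresentsWord (h : ℝ → ℝ) (W : List Bool) (ε : ℝ) : Prop :=
  ∀ t, 0 < t → 0 ≤ ε * h (1 - Real.exp t) ∧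
    ENNReal.ofReal (ε * h (1 - Real.exp t)) = iterInt W t

theorem one_sub_exp_lt_one (t : ℝ) : 1 - Real.exp t < 1 := by
  linarith [Real.exp_pos t]

theorem intervalIntegrable_of_analyticOnNhd {f : ℝ → ℝ} (hf : AnalyticOnNhd ℝ f (Iio 1)) {x : ℝ}
    (hx : x < 1) : IntervalIntegrable f volume 0 x :=
  (hf.continuousOn.mono fun _ ht => ht.2.trans_lt (max_lt one_pos hx)).intervalIntegrable

/-- The singularity at `0` is removable, with `dslope f 0` as continuous extension. -/
theorem intervalIntegrable_div_self {f : ℝ → ℝ} (hf : AnalyticOnNhd ℝ f (Iio 1)) (h0 : f 0 = 0)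
    {x : ℝ} (hx : x < 1) : IntervalIntegrable (fun t => f t / t) volume 0 x := by
  have hd : ContinuousOn (dslope f 0) (Iio 1) :=
    (continuousOn_dslope (Iio_mem_nhds one_pos)).2
      ⟨hf.continuousOn, (hf 0 (mem_Iio.2 one_pos)).differentiableAt⟩
  have hint : IntervalIntegrable (dslope f 0) volume 0 x :=
    (hd.mono fun _ ht => ht.2.trans_lt (max_lt one_pos hx)).intervalIntegrable
  refine hint.congr_ae (Filter.Eventually.filter_mono ae_restrict_le ?_)
  have : ∀ᵐ t : ℝ, t ≠ 0 := by simp [ae_iff]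
  filter_upwards [this] with t ht
  rw [dslope_of_ne f ht, slope_def_field, h0, sub_zero, sub_zero]

theorem RepresentsWord.intDivOneSub {h : ℝ → ℝ} {W : List Bool} {ε : ℝ}
    (hW : RepresentsWord h W ε) (hh : AnalyticOnNhd ℝ h (Iio 1)) :
    RepresentsWord (intDivOneSub h) (true :: W) (-ε) := by
  intro t ht
  have han : AnalyticOnNhd ℝ (fun x => h x / (1 - x)) (Iio 1) := fun x hx =>
    (hh x hx).div (analyticAt_const.sub analyticAt_id) (by
      have : x < 1 := hx
      simpa [sub_eq_zero] using this.ne')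
  refine integral_comp_one_sub_exp ht
    (intervalIntegrable_of_analyticOnNhd han (one_sub_exp_lt_one t)) fun s hs => ?_
  obtain ⟨h1, h2⟩ := hW s hs
  have he := Real.exp_pos s
  rw [sub_sub_cancel, ← mul_div_assoc, mul_div_cancel₀ _ he.ne', h2]
  exact ⟨div_nonneg h1 he.le, by simp [letterKernel]⟩

theorem RepresentsWord.intDivT {h : ℝ → ℝ} {W : List Bool} {ε : ℝ}
    (hW : RepresentsWord h W ε) (hh : AnalyticOnNhd ℝ h (Iio 1)) (h0 : h 0 = 0) :
    RepresentsWord (intDivT h) (false :: W) ε := by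
  intro t ht
  -- Division by `x < 0` flips the sign once and the backward path flips it again, so `dx/x`
  -- preserves `ε`.
  have := integral_comp_one_sub_exp (σ := -ε) (v := fun s => letterKernel false s * iterInt W s) ht
    (intervalIntegrable_div_self hh h0 (one_sub_exp_lt_one t)) fun s hs => ?_
  · rw [neg_neg] at this
    exact this
  obtain ⟨h1, h2⟩ := hW s hs
  have he : Real.exp s - 1 > 0 := by simpa using hs
  have hq : Real.exp (-s) < 1 := by simpa using hs
  have h3 : -ε * (h (1 - Real.exp s) / (1 - Real.exp s))
      = ε * h (1 - Real.exp s) / (Real.exp s - 1) := by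
    rw [← neg_sub (Real.exp s) 1, div_neg, mul_div_assoc]
    ring
  rw [h3]
  refine ⟨div_nonneg h1 he.le, ?_⟩
  have h4 : Real.exp s * (ε * h (1 - Real.exp s) / (Real.exp s - 1))
      = (1 - Real.exp (-s))⁻¹ * (ε * h (1 - Real.exp s)) := by
    have h5 : Real.exp s - 1 = Real.exp s * (1 - Real.exp (-s)) := by
      rw [mul_sub, ← Real.exp_add]
      simp
    have h6 : 1 - Real.exp (-s) ≠ 0 := by linarith
    have h7 := (Real.exp_pos s).ne'
    rw [h5]
    field_simp
  rw [h4, ENNReal.ofReal_mul (by rw [inv_nonneg]; linarith), h2,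
    ENNReal.ofReal_inv_of_pos (by linarith), ENNReal.ofReal_sub _ (Real.exp_pos _).le,
    ENNReal.ofReal_one]
  rfl

/-- Only `dx/(1-x)` changes the sign, and it occurs once per part. Vanishing at `0` is carried
through the iteration to keep `dx/x` integrable. -/
theorem representsWord_multiplePolylog (ks : List ℕ) :
    RepresentsWord (multiplePolylog ks) (polylogWord ks) ((-1) ^ ks.length) := by
  induction ks with
  | nil =>
    intro t _
    simp [multiplePolylog, polylogWord, iterInt]
  | cons k ks ih =>
    have han := analyticOnNhd_multiplePolylog ks
    have : ∀ j : ℕ, AnalyticOnNhd ℝ (intDivT^[j] (intDivOneSub (multiplePolylog ks))) (Iio 1) ∧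
        intDivT^[j] (intDivOneSub (multiplePolylog ks)) 0 = 0 ∧
        RepresentsWord (intDivT^[j] (intDivOneSub (multiplePolylog ks)))
          (List.replicate j false ++ true :: polylogWord ks) ((-1) ^ (ks.length + 1)) := by
      intro j
      induction j with
      | zero =>
        refine ⟨analyticOnNhd_intDivOneSub han, by simp [intDivOneSub], ?_⟩
        rw [pow_succ, mul_neg_one]
        exact ih.intDivOneSub han
      | succ j hj =>
        rw [Function.iterate_succ_apply']
        exact ⟨analyticOnNhd_intDivT hj.1 hj.2.1, by simp [intDivT], hj.2.2.intDivT hj.1 hj.2.1⟩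
    have h := (this (k - 1)).2.2
    have hword : polylogWord (k :: ks) = List.replicate (k - 1) false ++ true :: polylogWord ks := by
      simp [polylogWord]
    rw [hword]
    exact h

/-- The integrand of `(-1)^(r - 1) Γ(k + 1) η(k + 1; k)`. -/
noncomputable def etaReal {N : ℕ} (c : Composition N) (k : ℕ) (t : ℝ) : ℝ :=
  t ^ k * (Real.exp t - 1)⁻¹ * ((-1) ^ c.length * multiplePolylog c.blocks (1 - Real.exp t))

theorem etaReal_nonneg {N : ℕ} (c : Composition N) (k : ℕ) {t : ℝ} (ht : 0 < t) :
    0 ≤ etaReal c k t := by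
  have he : 0 < Real.exp t - 1 := by simpa using ht
  exact mul_nonneg (by positivity) (representsWord_multiplePolylog c.blocks t ht).1

theorem continuousOn_etaReal {N : ℕ} (c : Composition N) (k : ℕ) :
    ContinuousOn (etaReal c k) (Ioi 0) := by
  have h1 : ContinuousOn (fun t => multiplePolylog c.blocks (1 - Real.exp t)) (Ioi 0) :=
    (analyticOnNhd_multiplePolylog c.blocks).continuousOn.comp (by fun_prop)
      fun t _ => one_sub_exp_lt_one t
  have h2 : ContinuousOn (fun t => (Real.exp t - 1)⁻¹) (Ioi 0) :=
    ContinuousOn.inv₀ (by fun_prop) fun t ht => by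
      have : 0 < Real.exp t - 1 := by simpa using ht
      exact this.ne'
  unfold etaReal
  fun_prop

/-- Summability is required because `zetaStar` is a real `tsum`, which would be `0` for a divergent
series. -/
theorem lintegral_etaReal {N : ℕ} (hN : 0 < N) (c : Composition N) (k : ℕ)
    (hs : ∀ j ∈ Finset.Nat.antidiagonalTuple (hoffmanDual c.reverse).length k,
      Summable fun x : StarIndex (hoffmanDual c.reverse).length =>
        zetaTerm (dualPlus c + j) x.1) :
    ∫⁻ t in Ioi 0, ENNReal.ofReal (etaReal c k t) =
      ENNReal.ofReal (k.factorial *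
        ∑ j ∈ Finset.Nat.antidiagonalTuple (hoffmanDual c.reverse).length k,
          (binomProd (dualPlus c) j : ℝ) * zetaStar (dualPlus c + j)) := by
  obtain ⟨e, L, hL, -, -⟩ := exists_dualList_eq_cons (polylogWord c.blocks).reverse
  rw [ENNReal.ofReal_mul (by positivity), ← tsum_coeff_prod_invSub _ _ hs,
    ← tsum_coeff_nestedSum (dualPlus c) ((ofFn_dualPlus hN c).trans hL)]
  simp_rw [← foldr_letterStep_mul_invSub _ hL]
  rw [← lintegral_expSum_mul_iterInt, ← lintegral_const_mul _
    (f := fun t => expSum (fun _ => 1) k t * iterInt (polylogWord c.blocks) t)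
    ((measurable_expSum _ _).mul (measurable_iterInt _))]
  refine setLIntegral_congr_fun measurableSet_Ioi fun t ht => ?_
  have ht' : 0 < t := ht
  have he : 0 < Real.exp t - 1 := by simpa using ht'
  have hk : (k.factorial : ℝ) ≠ 0 := by positivity
  rw [expSum_one k ht', ← (representsWord_multiplePolylog c.blocks t ht').2,
    ← ENNReal.ofReal_mul (by positivity), ← ENNReal.ofReal_mul (by positivity)]
  congr 1
  change _ * ((-1) ^ c.blocks.length * _) = _
  field_simp

/-- Passing from `1 - e^t` to `e^t - 1` costs one sign, which turns `(-1)^r` into `(-1)^(r-1)`. -/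
theorem etaIntegrand_eq {N : ℕ} (hN : 0 < N) (c : Composition N) (k : ℕ) (t : ℝ) :
    etaIntegrand (k + 1) c t = (-1) ^ (c.length - 1) * (etaReal c k t : ℂ) := by
  have hc := c.length_pos_iff.2 hN
  obtain ⟨r, hr⟩ : ∃ r, c.length = r + 1 := ⟨c.length - 1, by omega⟩
  have h1 : ((-1 : ℂ) ^ r) * (-1) ^ r = 1 := by
    rw [← mul_pow]
    simp
  rw [etaIntegrand, etaReal, hr, add_sub_cancel_right, Complex.cpow_natCast, Nat.add_sub_cancel]
  generalize multiplePolylog c.blocks (1 - Real.exp t) = y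
  rw [← neg_sub (Real.exp t) 1]
  push_cast
  rw [div_neg, div_eq_mul_inv]
  linear_combination (t : ℂ) ^ k * (Complex.exp t - 1)⁻¹ * y * h1

end KanekoTsumura

/-! ### Evaluation of the η-function -/

theorem mainTheorem4 {N : ℕ} (hN : 0 < N) (c : Composition N) (k : ℕ) :
    MeasureTheory.IntegrableOn (KanekoTsumura.etaIntegrand (k + 1) c) (Set.Ioi 0) ∧
    (∀ j ∈ Finset.Nat.antidiagonalTuple (KanekoTsumura.hoffmanDual c.reverse).length k,
      Summable fun m : KanekoTsumura.StarIndex (KanekoTsumura.hoffmanDual c.reverse).length =>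
        KanekoTsumura.zetaTerm (KanekoTsumura.dualPlus c + j) m.1) ∧
    KanekoTsumura.eta (k + 1) c =
      (-1) ^ (c.length - 1) *
        ∑ j ∈ Finset.Nat.antidiagonalTuple (KanekoTsumura.hoffmanDual c.reverse).length k,
          (KanekoTsumura.binomProd (KanekoTsumura.dualPlus c) j : ℂ) *
            (KanekoTsumura.zetaStar (KanekoTsumura.dualPlus c + j) : ℂ) := by
  have hs : ∀ j ∈ Finset.Nat.antidiagonalTuple (KanekoTsumura.hoffmanDual c.reverse).length k,
      Summable fun x : KanekoTsumura.StarIndex (KanekoTsumura.hoffmanDual c.reverse).length =>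
        KanekoTsumura.zetaTerm (KanekoTsumura.dualPlus c + j) x.1 := by
    intro j _
    have h1 := (KanekoTsumura.hoffmanDual c.reverse).one_le_blocksFun
    refine KanekoTsumura.summable_zetaTerm _ (fun i => ?_) fun i hi => ?_
    · have := h1 i
      simp only [Pi.add_apply, KanekoTsumura.dualPlus, KanekoTsumura.addOneFirst]
      split_ifs <;> omega
    · have := h1 i
      simp only [Pi.add_apply, KanekoTsumura.dualPlus, KanekoTsumura.addOneFirst, hi, if_true]
      omega
  have hl := KanekoTsumura.lintegral_etaReal hN c k hs
  have hnn : 0 ≤ᵐ[MeasureTheory.volume.restrict (Set.Ioi 0)] KanekoTsumura.etaReal c k :=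
    (MeasureTheory.ae_restrict_iff' measurableSet_Ioi).2
      (Filter.Eventually.of_forall fun t ht => KanekoTsumura.etaReal_nonneg c k ht)
  have hint : MeasureTheory.IntegrableOn (KanekoTsumura.etaReal c k) (Set.Ioi 0) := by
    refine ⟨(KanekoTsumura.continuousOn_etaReal c k).aestronglyMeasurable measurableSet_Ioi, ?_⟩
    -- The value computed in `ℝ≥0∞` is the image of a real number, hence finite.
    rw [MeasureTheory.hasFiniteIntegral_iff_ofReal hnn, hl]
    exact ENNReal.ofReal_lt_top
  have hfun : KanekoTsumura.etaIntegrand (k + 1) c =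
      fun t => (-1) ^ (c.length - 1) * (KanekoTsumura.etaReal c k t : ℂ) :=
    funext (KanekoTsumura.etaIntegrand_eq hN c k)
  refine ⟨?_, hs, ?_⟩
  · rw [hfun]
    exact (MeasureTheory.Integrable.ofReal hint).const_mul _
  · have hval : ∫ t in Set.Ioi 0, KanekoTsumura.etaReal c k t = k.factorial *
        ∑ j ∈ Finset.Nat.antidiagonalTuple (KanekoTsumura.hoffmanDual c.reverse).length k,
          (KanekoTsumura.binomProd (KanekoTsumura.dualPlus c) j : ℝ) *
            KanekoTsumura.zetaStar (KanekoTsumura.dualPlus c + j) := by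
      rw [MeasureTheory.integral_eq_lintegral_of_nonneg_ae hnn hint.1, hl, ENNReal.toReal_ofReal]
      exact mul_nonneg (Nat.cast_nonneg _) (Finset.sum_nonneg fun j _ =>
        mul_nonneg (Nat.cast_nonneg _) (KanekoTsumura.zetaStar_nonneg _))
    have hk : (k.factorial : ℂ) ≠ 0 := by exact_mod_cast k.factorial_ne_zero
    rw [KanekoTsumura.eta, hfun, MeasureTheory.integral_const_mul, integral_complex_ofReal, hval,
      Complex.Gamma_nat_eq_factorial]
    push_cast
    field_simp
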